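/- **Corollary 7.2 (Strong subadditivity).** Let $\mathcal H_A,\mathcal H_B,\mathcal H_C$ be finite-dimensional complex Hilbert spaces and let $\rho=\rho_{ABC}$ be a faithful state (a positive definite operator of trace one) on $\mathcal H_A\otimes\mathcal H_B\otimes\mathcal H_C$. Write $\rho_{AB},\rho_{BC},\rho_B,\rho_C$ for its partial traces; an operator on some of the factors is extended to the whole space by tensoring with the identity. Let $S(\omega)=-\operatorname{Tr}(\omega\log\omega)$ (natural logarithm), $\|X\|_1=\operatorname{Tr}|X|$, $\|X\|_2=(\operatorname{Tr}X^*X)^{1/2}$, and let $\|X\|$ be the operator norm. Let $D=\|\Delta\|$ be the operator norm, with respect to $\|\cdot\|_2$, of the modular operator $\Delta(X)=(\rho_{AB}\otimes\rho_C)\,X\,\rho^{-1}$. For $\beta\in(0,1)$ put $s=1-2\beta+2\beta^2$ and $$\alpha(\beta)=\begin{cases}\beta(1-\beta),&\beta\le \tfrac12,\\ (1-\beta)/2,&\beta\ge\tfrac12,\end{cases}$$ $$N=\begin{cases}\left(\dfrac{\pi s\beta}{\sin\beta\pi}\right)^{\frac1{\beta(1-\beta)}}\left(1+\dfrac{\beta}{1-\beta}D\right)^{-\frac{s}{\beta(1-\beta)}}2^{-\frac{s}{\beta(1-\beta)}}\left(\dfrac{s}{2(1-\beta)}\right)^{-2},&\beta\le\tfrac12,\\[2ex]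 \left(\dfrac{\pi\beta(1-\beta)}{\sin\beta\pi}\right)^{\frac2{1-\beta}}\left(\dfrac{1-\beta}{\beta}+D\right)^{-\frac{2\beta}{1-\beta}}2^{-\frac{2\beta}{1-\beta}}\beta^{-2},&\beta\ge\tfrac12\end{cases}$$ (the two cases agree at $\beta=\tfrac12$). Then the following hold. 1. For every $\beta\in(0,1)$, $$N\,\big\|(\rho_B^\beta\otimes\rho_C^\beta)\,\rho_{BC}^{-\beta}\,\rho^{1/2}-(\rho_{AB}^\beta\otimes\rho_C^\beta)\,\rho^{1/2-\beta}\big\|_2^{1/\alpha(\beta)}\le S(\rho_{AB})+S(\rho_{BC})-S(\rho_{ABC})-S(\rho_B).$$ 2. With the Petz recovery map $\mathcal R_\rho(\gamma)=\rho^{1/2}\big(I_A\otimes\rho_{BC}^{-1/2}\,\gamma\,\rho_{BC}^{-1/2}\big)\rho^{1/2}$ for operators $\gamma$ on $\mathcal H_B\otimes\mathcal H_C$, $$\Big(\frac{\pi}{8}\Big)^4\|\rho^{-1}\|^{-2}\,\big\|\mathcal R_\rho(\rho_B\otimes\rho_C)-\rho_{AB}\otimes\rho_C\big\|_1^4\le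 S(\rho_{AB})+S(\rho_{BC})-S(\rho_{ABC})-S(\rho_B).$$ 3. $S(\rho_{AB})+S(\rho_{BC})-S(\rho_{ABC})-S(\rho_B)=0$ if and only if $\mathcal R_\rho(\rho_B\otimes\rho_C)=\rho_{AB}\otimes\rho_C$. -/

import Mathlib

open scoped Kronecker ComplexOrder

noncomputable section

namespace QState

variable {m n a b c : Type*}

/-- Real power `A ^ s` of a positive definite matrix, by the functional calculus. -/
def power [Fintype n] [DecidableEq n] (A : Matrix n n ℂ) (s : ℝ) : Matrix n n ℂ :=
  cfc (fun x : ℝ => x ^ s) A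

/-- The von Neumann entropy `S(A) = - Tr (A log A)` (natural logarithm). -/
def entropy [Fintype n] [DecidableEq n] (A : Matrix n n ℂ) : ℝ :=
  -((A * cfc Real.log A).trace).re

/-- A faithful state: a positive definite matrix of trace one. -/
def IsFaithfulState [Fintype n] (A : Matrix n n ℂ) : Prop :=
  A.PosDef ∧ A.trace = 1

/-! Norms. -/

open scoped Matrix.Norms.Frobenius in
/-- The Hilbert-Schmidt norm `(Tr A^* A)^(1/2)`. -/
def hsNorm [Fintype m] [Fintype n] (A : Matrix m n ℂ) : ℝ := ‖A‖

/-- The trace norm `Tr |A|`, with `|A| = (A^* A)^(1/2)`. -/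
def traceNorm [Fintype n] [DecidableEq n] (A : Matrix n n ℂ) : ℝ :=
  ((cfc Real.sqrt (A.conjTranspose * A)).trace).re

open scoped Matrix.Norms.L2Operator in
/-- The operator norm of a matrix acting on the Hilbert space `ℂ^n`. -/
def opNorm [Fintype n] [DecidableEq n] (A : Matrix n n ℂ) : ℝ := ‖A‖

/-- The modular operator `Δ_{A,B} : X ↦ A X B⁻¹`. -/
def modular [Fintype n] [DecidableEq n] (A B : Matrix n n ℂ) :
    Matrix n n ℂ →ₗ[ℂ] Matrix n n ℂ :=
  LinearMap.mulLeft ℂ A ∘ₗ LinearMap.mulRight ℂ B⁻¹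

/-- The operator norm of a linear map on matrices, with respect to the Hilbert-Schmidt norm:
the least `C ≥ 0` with `‖Φ(X)‖₂ ≤ C ‖X‖₂` for all `X`. -/
def superNorm [Fintype n] (Φ : Matrix n n ℂ →ₗ[ℂ] Matrix n n ℂ) : ℝ :=
  sInf {C : ℝ | 0 ≤ C ∧ ∀ X : Matrix n n ℂ, hsNorm (Φ X) ≤ C * hsNorm X}

/-! Partial traces. The space `H_A ⊗ H_B ⊗ H_C` has the index type `a × (b × c)`. -/

/-- Partial trace over the first tensor factor. -/
def traceFst [Fintype m] (M : Matrix (m × n) (m × n) ℂ) : Matrix n n ℂ :=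
  Matrix.of fun j j' => ∑ i, M (i, j) (i, j')

/-- Partial trace over the second tensor factor. -/
def traceSnd [Fintype n] (M : Matrix (m × n) (m × n) ℂ) : Matrix m m ℂ :=
  Matrix.of fun i i' => ∑ j, M (i, j) (i', j)

/-- `ρ_AB` -/
def redAB [Fintype c] (ρ : Matrix (a × b × c) (a × b × c) ℂ) : Matrix (a × b) (a × b) ℂ :=
  traceSnd (Matrix.reindex (Equiv.prodAssoc a b c).symm (Equiv.prodAssoc a b c).symm ρ)

/-- `ρ_BC` -/
def redBC [Fintype a] (ρ : Matrix (a × b × c) (a × b × c) ℂ) : Matrix (b × c) (b × c) ℂ :=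
  traceFst ρ

/-- `ρ_B` -/
def redB [Fintype a] [Fintype c] (ρ : Matrix (a × b × c) (a × b × c) ℂ) : Matrix b b ℂ :=
  traceSnd (redBC ρ)

/-- `ρ_C` -/
def redC [Fintype a] [Fintype b] (ρ : Matrix (a × b × c) (a × b × c) ℂ) : Matrix c c ℂ :=
  traceFst (redBC ρ)

/-- The operator `X ⊗ Y` on `H_A ⊗ H_B ⊗ H_C`, for `X` on `H_A ⊗ H_B` and `Y` on `H_C`. -/
def tensorABC (X : Matrix (a × b) (a × b) ℂ) (Y : Matrix c c ℂ) :
    Matrix (a × b × c) (a × b × c) ℂ :=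
  Matrix.reindex (Equiv.prodAssoc a b c) (Equiv.prodAssoc a b c) (X ⊗ₖ Y)

/-- The operator `I ⊗ Z` on the bipartite space, for `Z` on the second factor. -/
def ampl [DecidableEq m] (Z : Matrix n n ℂ) : Matrix (m × n) (m × n) ℂ :=
  (1 : Matrix m m ℂ) ⊗ₖ Z

/-- Petz recovery map for the partial trace over the first factor:
`γ ↦ ρ^(1/2) (I ⊗ ρ₁^(-1/2) γ ρ₁^(-1/2)) ρ^(1/2)`, where `ρ₁` is the partial trace of `ρ`. -/
def petz [Fintype m] [DecidableEq m] [Fintype n] [DecidableEq n]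
    (ρ : Matrix (m × n) (m × n) ℂ) (γ : Matrix n n ℂ) : Matrix (m × n) (m × n) ℂ :=
  power ρ (1 / 2) *
    ampl (power (traceFst ρ) (-(1 / 2)) * γ * power (traceFst ρ) (-(1 / 2))) *
    power ρ (1 / 2)

/-! The exponent and the constant. -/

/-- The exponent `α(β)`. -/
def alpha (β : ℝ) : ℝ := if β ≤ 1 / 2 then β * (1 - β) else (1 - β) / 2

/-- The constant `N`, as a function of `β` and `D`. -/
def constN (β D : ℝ) : ℝ :=
  if β ≤ 1 / 2 then
    (Real.pi * (1 - 2 * β + 2 * β ^ 2) * β / Real.sin (β * Real.pi)) ^ (1 / (β * (1 - β)))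
      * (1 + β / (1 - β) * D) ^ (-((1 - 2 * β + 2 * β ^ 2) / (β * (1 - β))))
      * (2 : ℝ) ^ (-((1 - 2 * β + 2 * β ^ 2) / (β * (1 - β))))
      * ((1 - 2 * β + 2 * β ^ 2) / (2 * (1 - β))) ^ (-2 : ℝ)
  else
    (Real.pi * β * (1 - β) / Real.sin (β * Real.pi)) ^ (2 / (1 - β))
      * ((1 - β) / β + D) ^ (-(2 * β / (1 - β)))
      * (2 : ℝ) ^ (-(2 * β / (1 - β)))
      * β ^ (-2 : ℝ)

end QState

end

open scoped Kronecker ComplexOrder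

noncomputable section

namespace QState

set_option linter.unusedSectionVars false

section

open MeasureTheory Set Filter Topology

/-! ### Scalar integrals -/

/-! Put `σ = ρ_AB ⊗ ρ_C` and `τ = ρ_B ⊗ ρ_C`, so that `τ` is the partial trace of `σ` over A. The
entropy expression equals `S(ρ‖σ) - S(ρ_BC‖τ)` (`relEntropy_sub_relEntropy`), so everything is a
statement about the data processing inequality for this partial trace.

Relative entropy is `-⟨ρ^(1/2), log Δ ρ^(1/2)⟩` with `Δ X = σ X ρ⁻¹`. Let `Δ'` be the modular
operator of `τ` and `ρ_BC`. The isometry `U X = (I ⊗ X ρ_BC^(-1/2)) ρ^(1/2)` sends `v = ρ_BC^(1/2)`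
to `u = ρ^(1/2)` and satisfies `U* Δ U = Δ'` (`modularEmbedding_embedding`). In eigenbases both
operators become diagonal, and only the relations collected in `Subordinate` matter.

Let `w(t) = U (t + Δ')⁻¹ v - (t + Δ)⁻¹ u`. Completing a square gives `⟨w, (t + Δ) w⟩ ≤ ⟨u, (t + Δ)⁻¹
u⟩ - ⟨v, (t + Δ')⁻¹ v⟩` (`resolvent_gap`). The right side is the derivative of a logarithmic
potential that increases to zero, so it integrates to at most the entropy deficit
(`integral_resolvent_le`). On the other hand `U Δ'^β v - Δ^β u` is, up to the factor `sin(πβ)/π`,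
the integral of `-t^β w(t)`. Cauchy–Schwarz on a middle range of `t` and crude bounds on the two
ends (`norm_sub_le`), followed by optimization of the cut-offs, give claim 1.

Claim 2 is the case `β = 1/2` with the spectra bounded by `‖ρ⁻¹‖`, passed from the 2-norm of square
roots to the trace norm by `traceNorm_sub_le`. For claim 3, claim 2 shows that zero deficit forces
recovery. Conversely, recovery turns the data processing inequality for the Petz map
(`modularContraction_coembedding`) into the reverse of the one for the partial trace, so the two
relative entropies agree. -/

theorem beta_eq_integral {p q : ℝ} (hp : 0 < p) (hq : 0 < q) :
    ProbabilityTheory.beta p q = ∫ x in Ioo (0 : ℝ) 1, x ^ (p - 1) * (1 - x) ^ (q - 1) := by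
  rw [ProbabilityTheory.beta_eq_betaIntegralReal _ _ hp hq, Complex.betaIntegral,
    intervalIntegral.integral_of_le zero_le_one, integral_Ioc_eq_integral_Ioo]
  have h : ∫ x in Ioo (0 : ℝ) 1, (x : ℂ) ^ ((p : ℂ) - 1) * (1 - (x : ℂ)) ^ ((q : ℂ) - 1)
      = ∫ x in Ioo (0 : ℝ) 1, ((x ^ (p - 1) * (1 - x) ^ (q - 1) : ℝ) : ℂ) := by
    refine setIntegral_congr_fun measurableSet_Ioo fun x hx => ?_
    have h1 := Complex.ofReal_cpow hx.1.le (p - 1)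
    have h2 := Complex.ofReal_cpow (sub_nonneg.2 hx.2.le) (q - 1)
    push_cast at h1 h2 ⊢
    rw [h1, h2]
  rw [h, integral_complex_ofReal, Complex.ofReal_re]

/-- `∫₀^∞ t^(β-1) / (1 + t) dt = π / sin (π β)`. -/
theorem integral_rpowIntegrand_one {β : ℝ} (h0 : 0 < β) (h1 : β < 1) :
    ∫ t in Ioi (0 : ℝ), Real.rpowIntegrand₀₁ β t 1 = Real.pi / Real.sin (β * Real.pi) := by
  have himg : (fun t : ℝ => t / (1 + t)) '' Ioi 0 = Ioo 0 1 := by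
    ext x
    simp only [mem_image, mem_Ioi, mem_Ioo]
    constructor
    · rintro ⟨t, ht, rfl⟩
      exact ⟨by positivity, by rw [div_lt_one (by positivity)]; linarith⟩
    · rintro ⟨hx0, hx1⟩
      have : 0 < 1 - x := by linarith
      exact ⟨x / (1 - x), by positivity, by field_simp; ring⟩
  have hinj : InjOn (fun t : ℝ => t / (1 + t)) (Ioi 0) := by
    intro x hx y hy hxy
    rw [mem_Ioi] at hx hy
    have h1 : 1 + x ≠ 0 := by positivity
    have h2 : 1 + y ≠ 0 := by positivity
    simp only [div_eq_div_iff h1 h2] at hxy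
    linarith
  have hder : ∀ t ∈ Ioi (0 : ℝ), HasDerivWithinAt (fun t : ℝ => t / (1 + t))
      (1 / (1 + t) ^ 2) (Ioi 0) t := by
    intro t ht
    rw [mem_Ioi] at ht
    have h2 : 1 + t ≠ 0 := by positivity
    have h3 : (1 * (1 + id t) - id t * 1) / (1 + id t) ^ 2 = 1 / (1 + t) ^ 2 := by
      simp only [id]; ring
    exact h3 ▸ ((hasDerivAt_id t).div ((hasDerivAt_id t).const_add 1) h2).hasDerivWithinAt
  -- The substitution `x = t / (1 + t)` turns the integral into the Beta integral `B(β, 1 - β)`,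
  -- which the reflection formula evaluates.
  have key := integral_image_eq_integral_abs_deriv_smul measurableSet_Ioi hder hinj
    (fun x => x ^ (β - 1) * (1 - x) ^ ((1 - β) - 1))
  rw [himg, ← beta_eq_integral h0 (by linarith), ProbabilityTheory.beta] at key
  rw [show β + (1 - β) = 1 by ring, Real.Gamma_one, div_one, Real.Gamma_mul_Gamma_one_sub,
    mul_comm Real.pi β] at key
  rw [key]
  refine setIntegral_congr_fun measurableSet_Ioi fun t ht => ?_
  rw [mem_Ioi] at ht
  have h2 : 0 < 1 + t := by positivity
  simp only [smul_eq_mul]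
  rw [Real.rpowIntegrand₀₁_eq_pow_div ⟨h0, h1⟩ ht.le zero_le_one, abs_of_pos (by positivity),
    show 1 - t / (1 + t) = (1 + t)⁻¹ by field_simp; ring, Real.div_rpow ht.le h2.le,
    Real.inv_rpow h2.le, ← Real.rpow_neg h2.le, show -(1 - β - 1) = (β - 1) + 1 by ring,
    Real.rpow_add h2, Real.rpow_one, add_comm t 1]
  have : (1 + t) ^ (β - 1) ≠ 0 := by positivity
  field_simp

theorem integral_rpowIntegrand {β x : ℝ} (h0 : 0 < β) (h1 : β < 1) (hx : 0 ≤ x) :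
    ∫ t in Ioi (0 : ℝ), Real.rpowIntegrand₀₁ β t x
      = Real.pi / Real.sin (β * Real.pi) * x ^ β := by
  rw [Real.integral_rpowIntegrand₀₁_eq_rpow_mul_const ⟨h0, h1⟩ hx,
    integral_rpowIntegrand_one h0 h1, mul_comm]

variable {ι κ : Type*} [Fintype ι] [Fintype κ]

theorem hasDerivAt_log_potential {lam : ι → ℝ} {mu : κ → ℝ} (hlam : ∀ i, 0 < lam i)
    (hmu : ∀ k, 0 < mu k) (p : ι → ℝ) (q : κ → ℝ) {t : ℝ} (ht : 0 ≤ t) :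
    HasDerivAt (fun t : ℝ => ∑ i, p i * Real.log (t + lam i) - ∑ k, q k * Real.log (t + mu k))
      (∑ i, p i / (t + lam i) - ∑ k, q k / (t + mu k)) t := by
  have key : ∀ c x : ℝ, 0 < x →
      HasDerivAt (fun t : ℝ => c * Real.log (t + x)) (c / (t + x)) t := by
    intro c x hx
    have h := (((hasDerivAt_id t).add_const x).log (by simp only [id]; positivity)).const_mul c
    simpa only [id, mul_one_div] using h
  exact HasDerivAt.sub (HasDerivAt.fun_sum fun i _ => key _ _ (hlam i))
    (HasDerivAt.fun_sum fun k _ => key _ _ (hmu k))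

/-- A logarithmic potential with nonnegative derivative and total mass zero increases to zero. -/
theorem log_potential_bounds {lam : ι → ℝ} {mu : κ → ℝ} {p : ι → ℝ} {q : κ → ℝ}
    (hlam : ∀ i, 0 < lam i) (hmu : ∀ k, 0 < mu k) (hpq : ∑ i, p i = ∑ k, q k)
    (hpos : ∀ t : ℝ, 0 < t → 0 ≤ ∑ i, p i / (t + lam i) - ∑ k, q k / (t + mu k)) :
    MonotoneOn (fun t : ℝ => ∑ i, p i * Real.log (t + lam i) - ∑ k, q k * Real.log (t + mu k))
        (Ici 0) ∧
      ∀ T : ℝ, 0 ≤ T →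
        ∑ i, p i * Real.log (T + lam i) - ∑ k, q k * Real.log (T + mu k) ≤ 0 := by
  have hd : ∀ t : ℝ, 0 ≤ t → HasDerivAt
      (fun t : ℝ => ∑ i, p i * Real.log (t + lam i) - ∑ k, q k * Real.log (t + mu k))
      (∑ i, p i / (t + lam i) - ∑ k, q k / (t + mu k)) t := by
    intro t ht
    exact hasDerivAt_log_potential hlam hmu p q ht
  have hmono : MonotoneOn
      (fun t : ℝ => ∑ i, p i * Real.log (t + lam i) - ∑ k, q k * Real.log (t + mu k)) (Ici 0) := by
    refine monotoneOn_of_deriv_nonneg (convex_Ici 0)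
      (fun t ht => (hd t ht).continuousAt.continuousWithinAt) ?_ ?_
    · intro t ht
      exact (hd t (interior_subset ht)).differentiableAt.differentiableWithinAt
    · intro t ht
      rw [(hd t (interior_subset ht)).deriv]
      rw [interior_Ici] at ht
      exact hpos t ht
  refine ⟨hmono, fun T hT => ?_⟩
  have hl : ∀ x : ℝ, Tendsto (fun t : ℝ => Real.log (t + x) - Real.log t) atTop (𝓝 0) :=
    fun x => Real.tendsto_log_comp_add_sub_log x
  have hlim : Tendsto
      (fun t : ℝ => ∑ i, p i * Real.log (t + lam i) - ∑ k, q k * Real.log (t + mu k))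
      atTop (𝓝 0) := by
    have h1 : Tendsto (fun t : ℝ => ∑ i, p i * (Real.log (t + lam i) - Real.log t)
        - ∑ k, q k * (Real.log (t + mu k) - Real.log t)) atTop
        (𝓝 (∑ i, p i * 0 - ∑ k, q k * 0)) :=
      (tendsto_finsetSum _ fun i _ => (hl (lam i)).const_mul (p i)).sub
        (tendsto_finsetSum _ fun k _ => (hl (mu k)).const_mul (q k))
    simp only [mul_zero, Finset.sum_const_zero, sub_zero] at h1
    -- Equality of the total masses allows `log t` to be subtracted from every logarithm.
    refine h1.congr fun t => ?_
    simp only [mul_sub, Finset.sum_sub_distrib, ← Finset.sum_mul, hpq]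
    ring
  exact ge_of_tendsto hlim (eventually_atTop.2 ⟨T, fun t ht => hmono hT (hT.trans ht) ht⟩)

/-- The logarithmic deficit dominates the integral of the difference of the resolvents. -/
theorem integral_resolvent_le {lam : ι → ℝ} {mu : κ → ℝ} {p : ι → ℝ} {q : κ → ℝ}
    (hlam : ∀ i, 0 < lam i) (hmu : ∀ k, 0 < mu k) (hpq : ∑ i, p i = ∑ k, q k)
    (hpos : ∀ t : ℝ, 0 < t → 0 ≤ ∑ i, p i / (t + lam i) - ∑ k, q k / (t + mu k))
    {ε T : ℝ} (hε : 0 ≤ ε) (hT : ε ≤ T) :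
    IntegrableOn (fun t : ℝ => ∑ i, p i / (t + lam i) - ∑ k, q k / (t + mu k)) (Ioc ε T) ∧
    ∫ t in Ioc ε T, (∑ i, p i / (t + lam i) - ∑ k, q k / (t + mu k))
      ≤ ∑ k, q k * Real.log (mu k) - ∑ i, p i * Real.log (lam i) := by
  have hd : ∀ t ∈ uIcc ε T, HasDerivAt
      (fun t : ℝ => ∑ i, p i * Real.log (t + lam i) - ∑ k, q k * Real.log (t + mu k))
      (∑ i, p i / (t + lam i) - ∑ k, q k / (t + mu k)) t := by
    intro t ht
    rw [uIcc_of_le hT] at ht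
    have ht : 0 ≤ t := hε.trans ht.1
    exact hasDerivAt_log_potential hlam hmu p q ht
  have hc : ContinuousOn (fun t : ℝ => ∑ i, p i / (t + lam i) - ∑ k, q k / (t + mu k))
      (uIcc ε T) := by
    rw [uIcc_of_le hT]
    refine ContinuousOn.sub (continuousOn_finsetSum _ fun i _ => ?_)
      (continuousOn_finsetSum _ fun k _ => ?_)
    · refine continuousOn_const.div (by fun_prop) fun t ht => ?_
      have := hlam i; have := hε.trans ht.1; positivity
    · refine continuousOn_const.div (by fun_prop) fun t ht => ?_
      have := hmu k; have := hε.trans ht.1; positivity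
  have hi := hc.intervalIntegrable (μ := volume)
  refine ⟨(intervalIntegrable_iff_integrableOn_Ioc_of_le hT).1 hi, ?_⟩
  rw [← intervalIntegral.integral_of_le hT, intervalIntegral.integral_eq_sub_of_hasDerivAt hd hi]
  obtain ⟨hm, hle⟩ := log_potential_bounds hlam hmu hpq hpos
  have h1 := hle T (hε.trans hT)
  have h2 := hm (self_mem_Ici) (mem_Ici.2 hε) hε
  simp only [zero_add] at h2
  linarith

/-- The minimum over `T` of `A T^p + B T^(-q)`. -/
theorem le_of_forall_rpow_add {x A B p q : ℝ} (hA : 0 < A) (hB : 0 < B) (hp : 0 < p) (hq : 0 < q)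
    (h : ∀ T : ℝ, 0 < T → x ≤ A * T ^ p + B * T ^ (-q)) :
    x ≤ B * ((p + q) / p) * (p * A / (q * B)) ^ (q / (p + q)) := by
  have hpq : 0 < p + q := by positivity
  have hr : 0 < q * B / (p * A) := by positivity
  -- The critical point, where `p A T^(p+q) = q B`.
  refine (h ((q * B / (p * A)) ^ (1 / (p + q))) (by positivity)).trans_eq ?_
  rw [← Real.rpow_mul hr.le, ← Real.rpow_mul hr.le,
    show 1 / (p + q) * p = 1 + -(q / (p + q)) by field_simp; ring,
    show 1 / (p + q) * -q = -(q / (p + q)) by field_simp,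
    Real.rpow_add hr, Real.rpow_one, Real.rpow_neg hr.le, ← Real.inv_rpow hr.le, inv_div]
  field_simp
  ring

end

section

open MeasureTheory Set Filter Topology

/-! ### Comparison of two diagonal operators along a linear map -/

/-- The vector `x` with its coordinates multiplied by `g`, as a linear function of `g`. -/
def scale {ι : Type*} (x : EuclideanSpace ℂ ι) : (ι → ℝ) →ₗ[ℝ] EuclideanSpace ℂ ι where
  toFun g := WithLp.toLp 2 fun i => (g i : ℂ) * x i
  map_add' g h := by ext i; simp [add_mul]
  map_smul' c g := by ext i; simp [mul_assoc]

@[simp] theorem scale_apply {ι : Type*} (x : EuclideanSpace ℂ ι) (g : ι → ℝ) (i : ι) :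
    scale x g i = (g i : ℂ) * x i := rfl

variable {ι κ : Type*} [Fintype ι] [Fintype κ]

theorem norm_scale_le {x : EuclideanSpace ℂ ι} {g : ι → ℝ} {L : ℝ} (hL : 0 ≤ L)
    (hg : ∀ i, |g i| ≤ L) : ‖scale x g‖ ≤ L * ‖x‖ := by
  refine abs_le_of_sq_le_sq' ?_ (by positivity) |>.2
  rw [mul_pow, EuclideanSpace.norm_sq_eq, EuclideanSpace.norm_sq_eq, Finset.mul_sum]
  refine Finset.sum_le_sum fun i _ => ?_
  rw [scale_apply, norm_mul, mul_pow, Complex.norm_real, Real.norm_eq_abs]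
  have := hg i
  gcongr

/-- `U` is a contraction that decreases the quadratic forms of the positive diagonal operators
`mu`, `lam`, and its adjoint maps `u` to `v`. -/
structure Subordinate (lam : ι → ℝ) (mu : κ → ℝ)
    (U : EuclideanSpace ℂ κ →ₗ[ℂ] EuclideanSpace ℂ ι)
    (u : EuclideanSpace ℂ ι) (v : EuclideanSpace ℂ κ) : Prop where
  lam_pos : ∀ i, 0 < lam i
  mu_pos : ∀ k, 0 < mu k
  contraction : ∀ x, ‖U x‖ ≤ ‖x‖
  form_le : ∀ x, ∑ i, lam i * ‖U x i‖ ^ 2 ≤ ∑ k, mu k * ‖x k‖ ^ 2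
  dual : ∀ x, (inner ℂ (U x) u).re = (inner ℂ x v).re
  norm_eq : ‖u‖ = ‖v‖

namespace Subordinate

variable {lam : ι → ℝ} {mu : κ → ℝ} {U : EuclideanSpace ℂ κ →ₗ[ℂ] EuclideanSpace ℂ ι}
  {u : EuclideanSpace ℂ ι} {v : EuclideanSpace ℂ κ}

/-- Expand the square with `x = (t + mu)⁻¹ v`: contraction and form comparison bound `⟨Ux, (t + lam)
Ux⟩` by `⟨x, (t + mu) x⟩`, and duality turns the cross term into `⟨x, v⟩`. Both equal `⟨v, (t +
mu)⁻¹ v⟩`. -/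
theorem resolvent_gap (h : Subordinate lam mu U u v) {t : ℝ} (ht : 0 < t) :
    ∑ i, (t + lam i) * ‖(U (scale v fun k => (t + mu k)⁻¹)
        - scale u fun i => (t + lam i)⁻¹) i‖ ^ 2
      ≤ ∑ i, ‖u i‖ ^ 2 / (t + lam i) - ∑ k, ‖v k‖ ^ 2 / (t + mu k) := by
  set x := scale v fun k => (t + mu k)⁻¹ with hx
  have h1 : ∀ i, (t + lam i) * ‖(U x - scale u fun i => (t + lam i)⁻¹) i‖ ^ 2
      = t * ‖U x i‖ ^ 2 + lam i * ‖U x i‖ ^ 2 - 2 * (inner ℂ (U x i) (u i)).re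
        + ‖u i‖ ^ 2 / (t + lam i) := by
    intro i
    have := h.lam_pos i
    have h0 : t + lam i ≠ 0 := by positivity
    simp only [PiLp.sub_apply, scale_apply, Complex.sq_norm, Complex.normSq_apply,
      RCLike.inner_apply, Complex.sub_re, Complex.sub_im, Complex.mul_re, Complex.mul_im,
      Complex.conj_re, Complex.conj_im, Complex.ofReal_re, Complex.ofReal_im]
    field_simp
    ring
  have h2 : ∀ k, t * ‖x k‖ ^ 2 + mu k * ‖x k‖ ^ 2 = ‖v k‖ ^ 2 / (t + mu k) := by
    intro k
    have := h.mu_pos k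
    have h0 : 0 < t + mu k := by positivity
    rw [hx, scale_apply, norm_mul, Complex.norm_real, Real.norm_of_nonneg (by positivity)]
    field_simp
  have h3 : ∀ k, (inner ℂ (x k) (v k)).re = ‖v k‖ ^ 2 / (t + mu k) := by
    intro k
    rw [hx, scale_apply, Complex.sq_norm, Complex.normSq_apply]
    simp only [RCLike.inner_apply, Complex.mul_re, Complex.mul_im, map_mul,
      Complex.conj_re, Complex.conj_im, Complex.ofReal_re, Complex.ofReal_im]
    ring
  have hdual := h.dual x
  rw [PiLp.inner_apply, PiLp.inner_apply, Complex.re_sum, Complex.re_sum,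
    Finset.sum_congr rfl fun k _ => h3 k] at hdual
  have hcon : ∑ i, t * ‖U x i‖ ^ 2 ≤ ∑ k, t * ‖x k‖ ^ 2 := by
    rw [← Finset.mul_sum, ← Finset.mul_sum, ← EuclideanSpace.norm_sq_eq,
      ← EuclideanSpace.norm_sq_eq]
    have := h.contraction x
    gcongr
  have hsum := Finset.sum_congr rfl fun k (_ : k ∈ Finset.univ) => h2 k
  rw [Finset.sum_add_distrib] at hsum
  rw [Finset.sum_congr rfl fun i _ => h1 i, Finset.sum_add_distrib, Finset.sum_sub_distrib,
    Finset.sum_add_distrib, ← Finset.mul_sum _ _ (2 : ℝ), hdual]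
  linarith [h.form_le x]

theorem resolvent_nonneg (h : Subordinate lam mu U u v) (t : ℝ) (ht : 0 < t) :
    0 ≤ ∑ i, ‖u i‖ ^ 2 / (t + lam i) - ∑ k, ‖v k‖ ^ 2 / (t + mu k) := by
  refine le_trans (Finset.sum_nonneg fun i _ => ?_) (h.resolvent_gap ht)
  have := h.lam_pos i
  positivity

theorem sum_eq (h : Subordinate lam mu U u v) : ∑ i, ‖u i‖ ^ 2 = ∑ k, ‖v k‖ ^ 2 := by
  rw [← EuclideanSpace.norm_sq_eq, ← EuclideanSpace.norm_sq_eq, h.norm_eq]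

/-- Monotonicity of the relative entropy. -/
theorem deficit_nonneg (h : Subordinate lam mu U u v) :
    0 ≤ ∑ k, ‖v k‖ ^ 2 * Real.log (mu k) - ∑ i, ‖u i‖ ^ 2 * Real.log (lam i) := by
  have := (log_potential_bounds h.lam_pos h.mu_pos h.sum_eq h.resolvent_nonneg).2 0 le_rfl
  simp only [zero_add] at this
  linarith

/-- A compression of an operator bounded by `L` is bounded by `L`; test on a basis vector. Hence one
bound on `lam` serves both spectra in the stability estimate. -/
theorem mu_le [DecidableEq κ] (h : Subordinate lam mu U u v)
    (hform : ∀ x, ∑ i, lam i * ‖U x i‖ ^ 2 = ∑ k, mu k * ‖x k‖ ^ 2)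
    {L : ℝ} (hL : ∀ i, lam i ≤ L) (k : κ) : mu k ≤ L := by
  set x : EuclideanSpace ℂ κ := EuclideanSpace.single k 1
  have hx : ‖x‖ = 1 := by simp [x]
  have h1 : ∑ j, mu j * ‖x j‖ ^ 2 = mu k := by
    rw [Finset.sum_eq_single k]
    · simp [x]
    · intro j _ hj
      simp [x, hj]
    · simp
  have h2 : ∑ i, lam i * ‖U x i‖ ^ 2 ≤ L * ‖U x‖ ^ 2 := by
    rw [EuclideanSpace.norm_sq_eq, Finset.mul_sum]
    exact Finset.sum_le_sum fun i _ => mul_le_mul_of_nonneg_right (hL i) (by positivity)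
  have h3 : 0 ≤ ‖U x‖ := norm_nonneg _
  have h4 := h.contraction x
  rw [hx] at h4
  rw [hform, h1] at h2
  have h5 : 0 < L := by
    by_contra hneg
    have := h.mu_pos k
    nlinarith [sq_nonneg ‖U x‖]
  exact h2.trans (mul_le_of_le_one_right h5.le (pow_le_one₀ h3 h4))

/-- The basic estimate, before optimization over `ε` and `T`. -/
theorem norm_sub_le (h : Subordinate lam mu U u v) (hUv : U v = u) (hv : ‖v‖ = 1)
    {β : ℝ} (h0 : 0 < β) (h1 : β < 1) {L : ℝ} (hlam : ∀ i, lam i ≤ L) (hmu : ∀ k, mu k ≤ L)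
    {d : ℝ} (hd : 0 < d)
    (hdef : ∑ k, ‖v k‖ ^ 2 * Real.log (mu k) - ∑ i, ‖u i‖ ^ 2 * Real.log (lam i) ≤ d ^ 2)
    {ε T M : ℝ} (hε : 0 ≤ ε) (hT : 0 < T) (hεT : ε ≤ T) (hM : 0 < M)
    (hMint : ∫ t in Ioc ε T, t ^ (2 * β - 1) ≤ M ^ 2) :
    Real.pi / Real.sin (β * Real.pi) * ‖U (scale v fun k => mu k ^ β) - scale u fun i => lam i ^ β‖
      ≤ 2 * (ε ^ β / β) + M * d + 2 * (L * (T ^ (β - 1) / (1 - β))) := by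
  have hL : 0 ≤ L ∨ IsEmpty ι := by
    rcases isEmpty_or_nonempty ι with hi | ⟨⟨i⟩⟩
    · exact Or.inr hi
    · exact Or.inl ((h.lam_pos i).le.trans (hlam i))
  have hu : ‖u‖ = 1 := h.norm_eq.trans hv
  replace hL : 0 ≤ L := by
    refine hL.resolve_right fun hi => ?_
    rw [Subsingleton.elim u 0, norm_zero] at hu
    exact zero_ne_one hu
  set G : ℝ → EuclideanSpace ℂ ι := fun t =>
    U (scale v fun k => Real.rpowIntegrand₀₁ β t (mu k))
      - scale u fun i => Real.rpowIntegrand₀₁ β t (lam i) with hG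
  have hβ : β ∈ Ioo (0 : ℝ) 1 := ⟨h0, h1⟩
  have hGint : IntegrableOn G (Ioi 0) ∧ ∫ t in Ioi 0, G t
      = (Real.pi / Real.sin (β * Real.pi)) •
        (U (scale v fun k => mu k ^ β) - scale u fun i => lam i ^ β) := by
    -- The vectors depend linearly on the spectral function, so the scalar integral formula for
    -- `x^β` can be applied coordinatewise and then pushed through these continuous maps.
    set A : (κ → ℝ) →L[ℝ] EuclideanSpace ℂ ι :=
      LinearMap.toContinuousLinearMap ((U.restrictScalars ℝ).comp (scale v)) with hA
    set B : (ι → ℝ) →L[ℝ] EuclideanSpace ℂ ι := LinearMap.toContinuousLinearMap (scale u) with hB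
    have i1 : IntegrableOn (fun t k => Real.rpowIntegrand₀₁ β t (mu k)) (Ioi 0) :=
      Integrable.of_eval fun k => Real.integrableOn_rpowIntegrand₀₁_Ioi hβ (h.mu_pos k).le
    have i2 : IntegrableOn (fun t i => Real.rpowIntegrand₀₁ β t (lam i)) (Ioi 0) :=
      Integrable.of_eval fun k => Real.integrableOn_rpowIntegrand₀₁_Ioi hβ (h.lam_pos k).le
    have e1 : ∫ t in Ioi (0 : ℝ), (fun k => Real.rpowIntegrand₀₁ β t (mu k))
        = (Real.pi / Real.sin (β * Real.pi)) • fun k => mu k ^ β := by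
      funext k
      rw [eval_integral fun k => Real.integrableOn_rpowIntegrand₀₁_Ioi hβ (h.mu_pos k).le]
      exact integral_rpowIntegrand h0 h1 (h.mu_pos k).le
    have e2 : ∫ t in Ioi (0 : ℝ), (fun i => Real.rpowIntegrand₀₁ β t (lam i))
        = (Real.pi / Real.sin (β * Real.pi)) • fun i => lam i ^ β := by
      funext k
      rw [eval_integral fun k => Real.integrableOn_rpowIntegrand₀₁_Ioi hβ (h.lam_pos k).le]
      exact integral_rpowIntegrand h0 h1 (h.lam_pos k).le
    have hGe : G = fun t => A (fun k => Real.rpowIntegrand₀₁ β t (mu k))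
        - B (fun i => Real.rpowIntegrand₀₁ β t (lam i)) := rfl
    refine ⟨hGe ▸ (A.integrable_comp i1).sub (B.integrable_comp i2), ?_⟩
    rw [hGe, integral_sub (A.integrable_comp i1) (B.integrable_comp i2),
      A.integral_comp_comm i1, B.integral_comp_comm i2, e1, e2, map_smul, map_smul, ← smul_sub]
    rfl
  -- The integrand is `t^β (t⁻¹ - (t + x)⁻¹)`; its `t⁻¹` parts cancel because `U v = u`.
  have hGres : ∀ t : ℝ, 0 < t → G t = -((t ^ β) •
      (U (scale v fun k => (t + mu k)⁻¹) - scale u fun i => (t + lam i)⁻¹)) := by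
    intro t ht
    have a1 : (fun k => Real.rpowIntegrand₀₁ β t (mu k))
        = (t ^ β * t⁻¹) • (fun _ => (1 : ℝ)) - (t ^ β) • fun k => (t + mu k)⁻¹ := by
      funext k; simp [Real.rpowIntegrand₀₁]; ring
    have a2 : (fun k => Real.rpowIntegrand₀₁ β t (lam k))
        = (t ^ β * t⁻¹) • (fun _ => (1 : ℝ)) - (t ^ β) • fun k => (t + lam k)⁻¹ := by
      funext k; simp [Real.rpowIntegrand₀₁]; ring
    have a3 : scale v (fun _ => (1 : ℝ)) = v := by ext k; simp
    have a4 : scale u (fun _ => (1 : ℝ)) = u := by ext k; simp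
    have hUs : ∀ (r : ℝ) (x : EuclideanSpace ℂ κ), U (r • x) = r • U x :=
      fun r x => (U.restrictScalars ℝ).map_smul r x
    simp only [hG]
    rw [a1, a2, map_sub (scale v), map_sub U, map_sub (scale u), map_smul (scale v),
      map_smul (scale v), map_smul (scale u), map_smul (scale u), a3, a4, hUs, hUs, hUv, smul_sub]
    abel
  have hbound : ∀ (t c : ℝ), 0 < t → 0 ≤ c → (∀ x, 0 < x → x ≤ L →
      Real.rpowIntegrand₀₁ β t x ≤ c) → ‖G t‖ ≤ 2 * c := by
    intro t c ht hc hle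
    have b1 : ‖U (scale v fun k => Real.rpowIntegrand₀₁ β t (mu k))‖ ≤ c * 1 := by
      refine (h.contraction _).trans (hv ▸ norm_scale_le hc fun k => ?_)
      rw [abs_of_nonneg (Real.rpowIntegrand₀₁_nonneg h0 ht.le (h.mu_pos k).le)]
      exact hle _ (h.mu_pos k) (hmu k)
    have b2 : ‖scale u fun k => Real.rpowIntegrand₀₁ β t (lam k)‖ ≤ c * 1 := by
      refine hu ▸ norm_scale_le hc fun k => ?_
      rw [abs_of_nonneg (Real.rpowIntegrand₀₁_nonneg h0 ht.le (h.lam_pos k).le)]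
      exact hle _ (h.lam_pos k) (hlam k)
    linarith [_root_.norm_sub_le (U (scale v fun k => Real.rpowIntegrand₀₁ β t (mu k)))
      (scale u fun k => Real.rpowIntegrand₀₁ β t (lam k))]
  have hsmall : ‖∫ t in Ioc 0 ε, G t‖ ≤ 2 * (ε ^ β / β) := by
    have hi : IntegrableOn (fun t : ℝ => 2 * t ^ (β - 1)) (Ioc 0 ε) :=
      ((intervalIntegrable_iff_integrableOn_Ioc_of_le hε).1
        (intervalIntegral.intervalIntegrable_rpow' (by linarith))).const_mul 2
    refine (norm_integral_le_of_norm_le hi ?_).trans_eq ?_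
    · refine (ae_restrict_iff' measurableSet_Ioc).2 (ae_of_all _ fun t ht => ?_)
      exact hbound t _ ht.1 (Real.rpow_nonneg ht.1.le _) fun x hx _ =>
        Real.rpowIntegrand₀₁_le_rpow_sub_one hβ ht.1.le hx.le
    · rw [integral_const_mul, ← intervalIntegral.integral_of_le hε,
        integral_rpow (Or.inl (by linarith)), sub_add_cancel, Real.zero_rpow h0.ne', sub_zero]
  have hlarge : ‖∫ t in Ioi T, G t‖ ≤ 2 * (L * (T ^ (β - 1) / (1 - β))) := by
    have hi : IntegrableOn (fun t : ℝ => 2 * (L * t ^ (β - 2))) (Ioi T) :=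
      ((integrableOn_Ioi_rpow_of_lt (by linarith) hT).const_mul L).const_mul 2
    refine (norm_integral_le_of_norm_le hi ?_).trans_eq ?_
    · refine (ae_restrict_iff' measurableSet_Ioi).2 (ae_of_all _ fun t ht => ?_)
      have ht : 0 < t := hT.trans ht
      refine hbound t _ ht (by positivity) fun x hx hxL => ?_
      refine (Real.rpowIntegrand₀₁_le_rpow_sub_two_mul_self hβ ht hx.le).trans ?_
      rw [mul_comm]
      gcongr
    · rw [integral_const_mul, integral_const_mul, integral_Ioi_rpow_of_lt (by linarith) hT,
        show β - 2 + 1 = -(1 - β) by ring, neg_div_neg_eq, neg_sub]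
  -- Cauchy–Schwarz in the form of a weighted AM–GM inequality: `t^β ‖w‖` is at most `d/(2M)
  -- t^(2β-1) + M/(2d) t ‖w‖²`, and each summand integrates to at most `M d / 2`.
  have hmid : ‖∫ t in Ioc ε T, G t‖ ≤ M * d := by
    obtain ⟨hi1, hle1⟩ := integral_resolvent_le h.lam_pos h.mu_pos h.sum_eq h.resolvent_nonneg
      hε hεT
    have hi2 : IntegrableOn (fun t : ℝ => t ^ (2 * β - 1)) (Ioc ε T) :=
      (intervalIntegrable_iff_integrableOn_Ioc_of_le hεT).1
        (intervalIntegral.intervalIntegrable_rpow' (by linarith))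
    refine (norm_integral_le_of_norm_le ((hi2.const_mul (d / (2 * M))).add
      (hi1.const_mul (M / (2 * d)))) ?_).trans ?_
    · refine (ae_restrict_iff' measurableSet_Ioc).2 (ae_of_all _ fun t ht => ?_)
      have ht : 0 < t := hε.trans_lt ht.1
      set w := U (scale v fun k => (t + mu k)⁻¹) - scale u fun i => (t + lam i)⁻¹ with hw
      have hw2 : t * ‖w‖ ^ 2 ≤ ∑ i, ‖u i‖ ^ 2 / (t + lam i) - ∑ k, ‖v k‖ ^ 2 / (t + mu k) := by
        refine le_trans ?_ (h.resolvent_gap ht)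
        rw [EuclideanSpace.norm_sq_eq, Finset.mul_sum]
        refine Finset.sum_le_sum fun i _ => ?_
        have := h.lam_pos i
        gcongr
        linarith
      rw [hGres t ht, norm_neg, norm_smul, Real.norm_of_nonneg (by positivity)]
      simp only [Pi.add_apply]
      refine le_trans ?_ (add_le_add_right (mul_le_mul_of_nonneg_left hw2 (by positivity)) _)
      have e : t ^ (2 * β - 1) * t = (t ^ β) ^ 2 := by
        rw [Real.rpow_sub_one ht.ne', mul_comm 2 β, Real.rpow_mul ht.le, Real.rpow_two]
        field_simp
      have e2 : d / (2 * M) * t ^ (2 * β - 1) + M / (2 * d) * (t * ‖w‖ ^ 2) - t ^ β * ‖w‖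
          = (d * t ^ β - M * t * ‖w‖) ^ 2 / (2 * M * d * t) := by
        rw [eq_div_of_mul_eq ht.ne' e]
        field_simp
        ring
      have : 0 ≤ (d * t ^ β - M * t * ‖w‖) ^ 2 / (2 * M * d * t) := by positivity
      linarith
    · simp only [Pi.add_apply]
      rw [integral_add (hi2.const_mul _) (hi1.const_mul _), integral_const_mul, integral_const_mul]
      have := mul_le_mul_of_nonneg_left hMint (show 0 ≤ d / (2 * M) by positivity)
      have := mul_le_mul_of_nonneg_left (hle1.trans hdef) (show 0 ≤ M / (2 * d) by positivity)
      have : d / (2 * M) * M ^ 2 + M / (2 * d) * d ^ 2 = M * d := by field_simp; ring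
      linarith
  have hsplit : ∫ t in Ioi 0, G t
      = (∫ t in Ioc 0 ε, G t) + (∫ t in Ioc ε T, G t) + ∫ t in Ioi T, G t := by
    have i1 := hGint.1.mono_set (Ioi_subset_Ioi hT.le)
    have i2 := hGint.1.mono_set (Ioi_subset_Ioi hε)
    rw [← Ioc_union_Ioi_eq_Ioi hε, setIntegral_union (Ioc_disjoint_Ioi le_rfl) measurableSet_Ioi
      (hGint.1.mono_set Ioc_subset_Ioi_self) i2, ← Ioc_union_Ioi_eq_Ioi hεT,
      setIntegral_union (Ioc_disjoint_Ioi le_rfl) measurableSet_Ioi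
      (i2.mono_set Ioc_subset_Ioi_self) i1, add_assoc]
  have hsin : 0 < Real.sin (β * Real.pi) :=
    Real.sin_pos_of_pos_of_lt_pi (by positivity) (by nlinarith [Real.pi_pos])
  have hC : 0 ≤ Real.pi / Real.sin (β * Real.pi) := div_nonneg Real.pi_pos.le hsin.le
  have := congrArg norm (hGint.2.symm.trans hsplit)
  rw [norm_smul, Real.norm_of_nonneg hC] at this
  rw [this]
  exact (norm_add₃_le).trans (by linarith)

end Subordinate

end

section

open MeasureTheory Set Filter Topology

/-! ### The optimal constants -/

/-- The base of the last power is the optimized bound on the norm, with `g = 1 - β`, `S = sin(βπ)`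
and `K = 1 + β/(1-β) D`. The identity says that the constant is exactly what makes this bound
equivalent to a bound by `d²`. It becomes algebraic after taking logarithms. -/
theorem constN_low_identity {β g s K S d : ℝ} (hβ : 0 < β) (hg : 0 < g) (hs : 0 < s) (hK : 0 < K)
    (hS : 0 < S) (hd : 0 < d) (hsum : s + 2 * (β * g) = 1) :
    (Real.pi * s * β / S) ^ (1 / (β * g)) * K ^ (-(s / (β * g))) * (2 : ℝ) ^ (-(s / (β * g)))
      * (s / (2 * g)) ^ (-2 : ℝ)
      * (S / Real.pi * (2 / β * K * (1 / s) * (s * d / (2 * (β * g) * (2 / β * K))) ^ (2 * (β * g))))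
        ^ (1 / (β * g)) = d ^ 2 := by
  have hpi := Real.pi_pos
  refine Real.log_injOn_pos (mem_Ioi.2 (by positivity)) (mem_Ioi.2 (by positivity)) ?_
  simp (disch := positivity) only [Real.log_mul, Real.log_div, Real.log_rpow, Real.log_pow,
    Real.log_one]
  obtain rfl : s = 1 - 2 * (β * g) := by linarith
  field_simp
  push_cast
  ring

theorem constN_high_identity {β g K S d : ℝ} (hβ : 0 < β) (hg : 0 < g) (hK : 0 < K)
    (hS : 0 < S) (hd : 0 < d) (hsum : β + g = 1) :
    (Real.pi * β * g / S) ^ (2 / g) * (g / β * K) ^ (-(2 * β / g)) * (2 : ℝ) ^ (-(2 * β / g))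
      * β ^ (-2 : ℝ)
      * (S / Real.pi * (2 / β * K * (1 / β) * (β * d / (g * (2 / β * K))) ^ g)) ^ (2 / g)
      = d ^ 2 := by
  have hpi := Real.pi_pos
  refine Real.log_injOn_pos (mem_Ioi.2 (by positivity)) (mem_Ioi.2 (by positivity)) ?_
  simp (disch := positivity) only [Real.log_mul, Real.log_div, Real.log_rpow, Real.log_pow,
    Real.log_one]
  obtain rfl : g = 1 - β := by linarith
  field_simp
  push_cast
  ring

theorem integral_rpow_le_low {β ε T : ℝ} (hβ : β ≤ 1 / 2) (hε : 0 < ε) (hT : ε ≤ T) :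
    ∫ t in Ioc ε T, t ^ (2 * β - 1) ≤ T * ε ^ (2 * β - 1) := by
  have h := norm_setIntegral_le_of_norm_le_const (μ := volume) (s := Ioc ε T)
    (f := fun t : ℝ => t ^ (2 * β - 1)) (C := ε ^ (2 * β - 1)) (by simp) (fun t ht => by
      rw [Real.norm_of_nonneg (Real.rpow_nonneg (hε.trans ht.1).le _)]
      exact Real.rpow_le_rpow_of_nonpos hε ht.1.le (by linarith))
  refine (le_abs_self _).trans (h.trans ?_)
  rw [Real.volume_real_Ioc_of_le hT, mul_comm]
  gcongr
  linarith

theorem integral_rpow_le_high {β T : ℝ} (hβ : 1 / 2 ≤ β) (hT : 0 < T) :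
    ∫ t in Ioc 0 T, t ^ (2 * β - 1) ≤ (T ^ β) ^ 2 := by
  rw [← intervalIntegral.integral_of_le hT.le, integral_rpow (Or.inl (by linarith)),
    sub_add_cancel, Real.zero_rpow (by linarith), sub_zero, ← Real.rpow_natCast, ← Real.rpow_mul hT.le,
    mul_comm β]
  push_cast
  exact div_le_self (by positivity) (by linarith)

namespace Subordinate

variable {ι κ : Type*} [Fintype ι] [Fintype κ]
  {lam : ι → ℝ} {mu : κ → ℝ} {U : EuclideanSpace ℂ κ →ₗ[ℂ] EuclideanSpace ℂ ι}
  {u : EuclideanSpace ℂ ι} {v : EuclideanSpace ℂ κ}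

/-- For `β ≥ 1/2` the weight `t^(2β-1)` is bounded near zero, so no lower cut-off is needed: take `ε
= 0` and `M = T^β`. -/
theorem norm_sub_le_high (h : Subordinate lam mu U u v) (hUv : U v = u) (hv : ‖v‖ = 1)
    {β : ℝ} (h0 : 1 / 2 ≤ β) (h1 : β < 1) {L : ℝ} (hlam : ∀ i, lam i ≤ L) (hmu : ∀ k, mu k ≤ L)
    {d : ℝ} (hd : 0 < d)
    (hdef : ∑ k, ‖v k‖ ^ 2 * Real.log (mu k) - ∑ i, ‖u i‖ ^ 2 * Real.log (lam i) ≤ d ^ 2)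
    {T : ℝ} (hT : 0 < T) :
    Real.pi / Real.sin (β * Real.pi) * ‖U (scale v fun k => mu k ^ β) - scale u fun i => lam i ^ β‖
      ≤ d * T ^ β + 2 * L / (1 - β) * T ^ (-(1 - β)) := by
  have hβ : 0 < β := by linarith
  refine (h.norm_sub_le hUv hv hβ h1 hlam hmu hd hdef le_rfl hT hT.le
    (Real.rpow_pos_of_pos hT β) (integral_rpow_le_high h0 hT)).trans_eq ?_
  rw [Real.zero_rpow hβ.ne', neg_sub]
  ring

/-- The lower cut-off is tied to `T` by `ε^β = T^(-(1-β))`, so both ends decay at the same rate.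
This requires `ε ≤ T`, hence the separate treatment of `T ≤ 1`. -/
theorem norm_sub_le_low (h : Subordinate lam mu U u v) (hUv : U v = u) (hv : ‖v‖ = 1)
    {β : ℝ} (h0 : 0 < β) (h1 : β ≤ 1 / 2) {L : ℝ} (hlam : ∀ i, lam i ≤ L) (hmu : ∀ k, mu k ≤ L)
    {d : ℝ} (hd : 0 < d)
    (hdef : ∑ k, ‖v k‖ ^ 2 * Real.log (mu k) - ∑ i, ‖u i‖ ^ 2 * Real.log (lam i) ≤ d ^ 2)
    {T : ℝ} (hT : 0 < T) :
    Real.pi / Real.sin (β * Real.pi) * ‖U (scale v fun k => mu k ^ β) - scale u fun i => lam i ^ β‖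
      ≤ d * T ^ ((1 - 2 * β + 2 * β ^ 2) / (2 * β))
        + (2 / β + 2 * L / (1 - β)) * T ^ (-(1 - β)) := by
  rcases le_total T 1 with hT1 | hT1
  -- With `ε = T` the middle range is empty, so `M` is free and is chosen to match the other case.
  · refine (h.norm_sub_le hUv hv h0 (by linarith) hlam hmu hd hdef hT.le hT le_rfl
      (Real.rpow_pos_of_pos hT ((1 - 2 * β + 2 * β ^ 2) / (2 * β)))
      (by simp only [Ioc_self, Measure.restrict_empty, integral_zero_measure]; positivity)).trans ?_
    have hle : T ^ β ≤ T ^ (-(1 - β)) := Real.rpow_le_rpow_of_exponent_ge hT hT1 (by linarith)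
    have hle2 : 2 * (T ^ β / β) ≤ 2 / β * T ^ (-(1 - β)) := by
      rw [show 2 / β * T ^ (-(1 - β)) = 2 * (T ^ (-(1 - β)) / β) by ring]
      gcongr
    rw [neg_sub] at hle2 ⊢
    linear_combination hle2
  · set ε := T ^ (-((1 - β) / β)) with hε
    have hεpos : 0 < ε := Real.rpow_pos_of_pos hT _
    have hβ1 : 0 < 1 - β := by linarith
    have hε1 : ε ≤ T := by
      refine le_trans ?_ hT1
      refine Real.rpow_le_one_of_one_le_of_nonpos hT1 ?_
      have : 0 < (1 - β) / β := by positivity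
      linarith
    have hεβ : ε ^ β = T ^ (-(1 - β)) := by
      rw [hε, ← Real.rpow_mul hT.le]
      congr 1
      field_simp
    refine (h.norm_sub_le hUv hv h0 (by linarith) hlam hmu hd hdef hεpos.le hT hε1
      (Real.rpow_pos_of_pos hT ((1 - 2 * β + 2 * β ^ 2) / (2 * β)))
      ((integral_rpow_le_low h1 hεpos hε1).trans_eq ?_)).trans_eq ?_
    · rw [hε, ← Real.rpow_mul hT.le, ← Real.rpow_natCast, ← Real.rpow_mul hT.le]
      nth_rewrite 1 [← Real.rpow_one T]
      rw [← Real.rpow_add hT]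
      congr 1
      push_cast
      field_simp
      ring
    · rw [hεβ, neg_sub]
      ring

theorem constN_mul_le (h : Subordinate lam mu U u v) (hUv : U v = u) (hv : ‖v‖ = 1)
    {β : ℝ} (h0 : 0 < β) (h1 : β < 1) {D : ℝ} (hD : 0 ≤ D)
    (hlam : ∀ i, lam i ≤ D) (hmu : ∀ k, mu k ≤ D) :
    constN β D * ‖U (scale v fun k => mu k ^ β) - scale u fun i => lam i ^ β‖ ^ (1 / alpha β)
      ≤ ∑ k, ‖v k‖ ^ 2 * Real.log (mu k) - ∑ i, ‖u i‖ ^ 2 * Real.log (lam i) := by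
  -- The deficit may vanish, while the optimal `T` involves division by `d`; so work with any `d²`
  -- exceeding the deficit.
  refine le_of_forall_gt_imp_ge_of_dense fun r hr => ?_
  have hrpos : 0 < r := h.deficit_nonneg.trans_lt hr
  obtain ⟨d, hd, rfl⟩ : ∃ d : ℝ, 0 < d ∧ r = d ^ 2 :=
    ⟨√r, Real.sqrt_pos.2 hrpos, (Real.sq_sqrt hrpos.le).symm⟩
  have hg : 0 < 1 - β := by linarith
  have hsin : 0 < Real.sin (β * Real.pi) :=
    Real.sin_pos_of_pos_of_lt_pi (by positivity) (by nlinarith [Real.pi_pos])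
  have hpi := Real.pi_pos
  have hK : 0 < 1 + β / (1 - β) * D := by positivity
  have hB : 2 / β + 2 * D / (1 - β) = 2 / β * (1 + β / (1 - β) * D) := by
    field_simp
  set x := ‖U (scale v fun k => mu k ^ β) - scale u fun i => lam i ^ β‖ with hx
  have hx0 : 0 ≤ x := norm_nonneg _
  have hdiv : ∀ R : ℝ, Real.pi / Real.sin (β * Real.pi) * x ≤ R →
      x ≤ Real.sin (β * Real.pi) / Real.pi * R := by
    intro R hR
    have := mul_le_mul_of_nonneg_left hR (show 0 ≤ Real.sin (β * Real.pi) / Real.pi by positivity)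
    refine le_of_eq_of_le ?_ this
    field_simp
  rcases le_or_gt β (1 / 2) with hβ | hβ
  · have hs : 0 < 1 - 2 * β + 2 * β ^ 2 := by nlinarith [sq_nonneg (1 - 2 * β)]
    have hsum : (1 - 2 * β + 2 * β ^ 2) + 2 * (β * (1 - β)) = 1 := by ring
    have key := le_of_forall_rpow_add hd (show 0 < 2 / β + 2 * D / (1 - β) by positivity)
      (show 0 < (1 - 2 * β + 2 * β ^ 2) / (2 * β) by positivity) hg
      (fun T hT => h.norm_sub_le_low hUv hv h0 hβ hlam hmu hd hr.le hT)
    rw [constN, alpha, if_pos hβ, if_pos hβ]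
    set s := 1 - 2 * β + 2 * β ^ 2 with hsdef
    have e0 : s / (2 * β) + (1 - β) = 1 / (2 * β) := by field_simp; linarith
    rw [hB, e0, show 1 / (2 * β) / (s / (2 * β)) = 1 / s by field_simp,
      show (1 - β) / (1 / (2 * β)) = 2 * (β * (1 - β)) by field_simp,
      show s / (2 * β) * d / ((1 - β) * (2 / β * (1 + β / (1 - β) * D)))
        = s * d / (2 * (β * (1 - β)) * (2 / β * (1 + β / (1 - β) * D))) by
        rw [div_mul_eq_mul_div, div_div]; ring] at key
    rw [← constN_low_identity h0 hg hs hK hsin hd hsum]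
    have := hdiv _ key
    gcongr
  -- The lower end contributes nothing here; the term `2 / β` is added only to reach the stated
  -- constant.
  · have key := le_of_forall_rpow_add hd (show 0 < 2 / β + 2 * D / (1 - β) by positivity) h0 hg
      (fun T hT => (h.norm_sub_le_high hUv hv hβ.le h1 hlam hmu hd hr.le hT).trans
        (add_le_add_right (mul_le_mul_of_nonneg_right
          (show 2 * D / (1 - β) ≤ 2 / β + 2 * D / (1 - β) by
            have : 0 < 2 / β := by positivity
            linarith) (Real.rpow_nonneg hT.le _)) _))
    rw [constN, alpha, if_neg hβ.not_ge, if_neg hβ.not_ge]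
    rw [hB, show β + (1 - β) = 1 by ring, div_one] at key
    have e1 : (1 - β) / β + D = (1 - β) / β * (1 + β / (1 - β) * D) := by field_simp
    rw [← constN_high_identity h0 hg hK hsin hd (by ring), e1, one_div_div]
    have := hdiv _ key
    gcongr

/-- The estimate at `β = 1/2`, with a constant that is linear in the bound of the spectra. -/
theorem half_pow_four_le (h : Subordinate lam mu U u v) (hUv : U v = u) (hv : ‖v‖ = 1)
    {L : ℝ} (hL : 0 < L) (hlam : ∀ i, lam i ≤ L) (hmu : ∀ k, mu k ≤ L) :
    (Real.pi / 4) ^ 4 * ‖U (scale v fun k => mu k ^ (1 / 2 : ℝ))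
        - scale u fun i => lam i ^ (1 / 2 : ℝ)‖ ^ 4
      ≤ L ^ 2 * (∑ k, ‖v k‖ ^ 2 * Real.log (mu k) - ∑ i, ‖u i‖ ^ 2 * Real.log (lam i)) := by
  rw [← div_le_iff₀' (by positivity)]
  refine le_of_forall_gt_imp_ge_of_dense fun r hr => ?_
  have hrpos : 0 < r := h.deficit_nonneg.trans_lt hr
  obtain ⟨d, hd, rfl⟩ : ∃ d : ℝ, 0 < d ∧ r = d ^ 2 :=
    ⟨√r, Real.sqrt_pos.2 hrpos, (Real.sq_sqrt hrpos.le).symm⟩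
  rw [div_le_iff₀' (by positivity)]
  -- The choice `T = 4L/d` balances `d √T` against `4L/√T`. Omitting the term `2 / β` keeps the
  -- bound homogeneous in `L`.
  have hb := h.norm_sub_le_high hUv hv le_rfl (by norm_num) hlam hmu hd hr.le
    (T := 4 * L / d) (by positivity)
  set x := ‖U (scale v fun k => mu k ^ (1 / 2 : ℝ)) - scale u fun i => lam i ^ (1 / 2 : ℝ)‖
  have hx0 : 0 ≤ x := norm_nonneg _
  rw [show (1 / 2 : ℝ) * Real.pi = Real.pi / 2 by ring, Real.sin_pi_div_two, div_one,
    show -(1 - 1 / 2 : ℝ) = -(1 / 2) by norm_num, Real.rpow_neg (by positivity),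
    ← Real.sqrt_eq_rpow] at hb
  set y := √(4 * L / d) with hy
  have hy0 : 0 < y := Real.sqrt_pos.2 (by positivity)
  have hy2 : d * y ^ 2 = 4 * L := by
    rw [hy, Real.sq_sqrt (by positivity)]; field_simp
  have hb2 : Real.pi * x ≤ 2 * d * y := by
    refine hb.trans_eq ?_
    field_simp
    linarith
  have := pow_le_pow_left₀ (by positivity) hb2 4
  have e : (2 * d * y) ^ 4 = 16 * d ^ 2 * (d * y ^ 2) ^ 2 := by ring
  rw [e, hy2] at this
  have : (Real.pi / 4) ^ 4 * x ^ 4 = (Real.pi * x) ^ 4 / 256 := by ring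
  nlinarith

end Subordinate

end

section

open Matrix

/-! ### Spectral data -/

/-- The matrix with eigenvectors the columns of `Q` and eigenvalues `q`. -/
def spec {n ι : Type*} [Fintype ι] [DecidableEq ι] (Q : Matrix n ι ℂ) (q : ι → ℝ) :
    Matrix n n ℂ :=
  Q * diagonal (fun i => (q i : ℂ)) * Qᴴ

variable {m n ι κ : Type*} [Fintype ι] [DecidableEq ι] [Fintype κ] [DecidableEq κ]

theorem spec_isHermitian (Q : Matrix n ι ℂ) (q : ι → ℝ) : (spec Q q).IsHermitian := by
  rw [Matrix.IsHermitian, spec, conjTranspose_mul, conjTranspose_mul, conjTranspose_conjTranspose,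
    diagonal_conjTranspose, Matrix.mul_assoc]
  congr 3
  funext i
  simp

theorem spec_mul_spec [Fintype n] {Q : Matrix n ι ℂ} (hQ : Qᴴ * Q = 1) (q r : ι → ℝ) :
    spec Q q * spec Q r = spec Q fun i => q i * r i := by
  have : Q * diagonal (fun i => (q i : ℂ)) * Qᴴ * (Q * diagonal (fun i => (r i : ℂ)) * Qᴴ)
      = Q * (diagonal (fun i => (q i : ℂ)) * (Qᴴ * Q) * diagonal (fun i => (r i : ℂ))) * Qᴴ := by
    simp only [Matrix.mul_assoc]
  rw [spec, spec, this, hQ, Matrix.mul_one, diagonal_mul_diagonal, spec]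
  simp only [Complex.ofReal_mul]

theorem spec_one [DecidableEq n] {Q : Matrix n ι ℂ} (hQ' : Q * Qᴴ = 1) : spec Q (fun _ => 1) = 1 := by
  simp [spec, hQ']

theorem trace_spec [Fintype n] {Q : Matrix n ι ℂ} (hQ : Qᴴ * Q = 1) (q : ι → ℝ) :
    (spec Q q).trace = ((∑ i, q i : ℝ) : ℂ) := by
  rw [spec, trace_mul_comm, ← Matrix.mul_assoc, hQ, Matrix.one_mul, trace_diagonal]
  push_cast
  rfl

/-- Diagonal matrices conjugated by `Q`, as a star algebra homomorphism. -/
def specHom [Fintype n] [DecidableEq n] (Q : Matrix n ι ℂ) (hQ : Qᴴ * Q = 1) (hQ' : Q * Qᴴ = 1) :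
    (ι → ℂ) →⋆ₐ[ℝ] Matrix n n ℂ where
  toFun q := Q * diagonal q * Qᴴ
  map_one' := by simp [hQ']
  map_mul' q r := by
    have : Q * diagonal q * Qᴴ * (Q * diagonal r * Qᴴ)
        = Q * (diagonal q * (Qᴴ * Q) * diagonal r) * Qᴴ := by
      simp only [Matrix.mul_assoc]
    rw [this, hQ, Matrix.mul_one, diagonal_mul_diagonal]
    rfl
  map_zero' := by simp
  map_add' q r := by
    rw [← Matrix.add_mul, ← Matrix.mul_add, diagonal_add]
    rfl
  commutes' r := by
    rw [show diagonal (algebraMap ℝ (ι → ℂ) r) = (r : ℂ) • (1 : Matrix ι ι ℂ) by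
      ext i j
      by_cases h : i = j <;> simp [h, diagonal, one_apply, Pi.algebraMap_apply]]
    rw [Matrix.mul_smul, Matrix.mul_one, Matrix.smul_mul, hQ', Algebra.algebraMap_eq_smul_one]
    ext i j
    simp [Matrix.smul_apply]
  map_star' q := by
    rw [star_eq_conjTranspose, conjTranspose_mul, conjTranspose_mul, conjTranspose_conjTranspose,
      diagonal_conjTranspose, Matrix.mul_assoc]

/-- On the finite set of eigenvalues `f` agrees with an interpolating polynomial, and polynomials
commute with the algebra homomorphism `specHom`. -/
theorem cfc_spec [Fintype n] [DecidableEq n] {Q : Matrix n ι ℂ} (hQ : Qᴴ * Q = 1) (hQ' : Q * Qᴴ = 1) (q : ι → ℝ)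
    (f : ℝ → ℝ) : cfc f (spec Q q) = spec Q fun i => f (q i) := by
  have hspec : spectrum ℝ (spec Q q) ⊆ Set.range q := by
    refine (AlgHom.spectrum_apply_subset (specHom Q hQ hQ').toAlgHom fun i => (q i : ℂ)).trans
      fun r hr => ?_
    by_contra hne
    refine hr ?_
    rw [spectrum.mem_resolventSet_iff, Pi.isUnit_iff]
    intro i
    have : r - q i ≠ 0 := fun h => hne ⟨i, by linarith⟩
    rw [isUnit_iff_ne_zero]
    simpa [Pi.algebraMap_apply, ← Complex.ofReal_sub] using this
  obtain ⟨P, hP⟩ : ∃ P : Polynomial ℝ, ∀ i, P.eval (q i) = f (q i) :=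
    ⟨Lagrange.interpolate (Finset.univ.image q) id f, fun i =>
      Lagrange.eval_interpolate_at_node (v := id) f (Set.injOn_id _)
        (Finset.mem_image_of_mem q (Finset.mem_univ i))⟩
  rw [cfc_congr (g := P.eval) (fun r hr => by obtain ⟨i, rfl⟩ := hspec hr; exact (hP i).symm)]
  refine (cfc_polynomial P (spec Q q) (spec_isHermitian Q q)).trans ?_
  change Polynomial.aeval ((specHom Q hQ hQ').toAlgHom fun i => (q i : ℂ)) P = _
  rw [Polynomial.aeval_algHom_apply]
  change specHom Q hQ hQ' _ = specHom Q hQ hQ' fun i => (f (q i) : ℂ)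
  congr 1
  funext i
  have h1 := Polynomial.aeval_algHom_apply (Pi.evalAlgHom ℝ (fun _ : ι => ℂ) i)
    (fun i => (q i : ℂ)) P
  have h2 := Polynomial.aeval_algebraMap_apply ℂ (q i) P
  rw [← hP i]
  simp only [Pi.evalAlgHom_apply] at h1
  rw [← h1]
  simpa using h2

theorem _root_.Matrix.IsHermitian.eq_spec [Fintype n] [DecidableEq n] {A : Matrix n n ℂ}
    (hA : A.IsHermitian) :
    A = spec (hA.eigenvectorUnitary : Matrix n n ℂ) hA.eigenvalues := by
  have := hA.spectral_theorem
  rw [Unitary.conjStarAlgAut_apply] at this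
  exact this

theorem spec_kronecker (Q : Matrix m ι ℂ) (q : ι → ℝ) (P : Matrix n κ ℂ) (p : κ → ℝ) :
    spec Q q ⊗ₖ spec P p = spec (Q ⊗ₖ P) fun k => q k.1 * p k.2 := by
  rw [spec, spec, spec, mul_kronecker_mul, mul_kronecker_mul, diagonal_kronecker_diagonal,
    conjTranspose_kronecker]
  simp only [Complex.ofReal_mul]

theorem spec_reindex (e : m ≃ n) (Q : Matrix m ι ℂ) (q : ι → ℝ) :
    reindex e e (spec Q q) = spec (Q.submatrix e.symm id) q := by
  rw [spec, spec, reindex_apply, conjTranspose_submatrix]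
  ext i j
  simp [mul_apply]

end

/-! ### Diagonalization of positive definite matrices, with a free index type for the eigenbasis. -/

section

open Matrix

/-- `Q` is a unitary change of basis that diagonalizes the positive definite matrix `A`, with
eigenvalues `q`. -/
structure IsSpec {n ι : Type*} [Fintype n] [DecidableEq n] [Fintype ι] [DecidableEq ι]
    (A : Matrix n n ℂ) (Q : Matrix n ι ℂ) (q : ι → ℝ) : Prop where
  left : Qᴴ * Q = 1
  right : Q * Qᴴ = 1
  pos : ∀ i, 0 < q i
  eq : A = spec Q q

variable {m n ι κ : Type*} [Fintype m] [DecidableEq m] [Fintype n] [DecidableEq n]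
  [Fintype ι] [DecidableEq ι] [Fintype κ] [DecidableEq κ]

theorem exists_isSpec {A : Matrix n n ℂ} (hA : A.PosDef) :
    ∃ (Q : Matrix n n ℂ) (q : n → ℝ), IsSpec A Q q := by
  exact ⟨hA.isHermitian.eigenvectorUnitary, hA.isHermitian.eigenvalues,
    Unitary.coe_star_mul_self _, Unitary.coe_mul_star_self _, hA.eigenvalues_pos,
    hA.isHermitian.eq_spec⟩

namespace IsSpec

variable {A : Matrix n n ℂ} {Q : Matrix n ι ℂ} {q : ι → ℝ}
  {B : Matrix m m ℂ} {P : Matrix m κ ℂ} {p : κ → ℝ}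

theorem cfc_eq (h : IsSpec A Q q) (f : ℝ → ℝ) : cfc f A = spec Q fun i => f (q i) := by
  rw [h.eq, cfc_spec h.left h.right]

theorem power_eq (h : IsSpec A Q q) (s : ℝ) : power A s = spec Q fun i => q i ^ s :=
  h.cfc_eq _

theorem inv_eq (h : IsSpec A Q q) : A⁻¹ = spec Q fun i => (q i)⁻¹ := by
  refine Matrix.inv_eq_right_inv ?_
  rw [h.eq, spec_mul_spec h.left, ← spec_one h.right]
  congr 1
  funext i
  exact mul_inv_cancel₀ (h.pos i).ne'

theorem kronecker (h : IsSpec A Q q) (h' : IsSpec B P p) :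
    IsSpec (A ⊗ₖ B) (Q ⊗ₖ P) fun k => q k.1 * p k.2 where
  left := by rw [conjTranspose_kronecker, ← mul_kronecker_mul, h.left, h'.left, one_kronecker_one]
  right := by
    rw [conjTranspose_kronecker, ← mul_kronecker_mul, h.right, h'.right, one_kronecker_one]
  pos k := mul_pos (h.pos _) (h'.pos _)
  eq := by rw [h.eq, h'.eq, spec_kronecker]

theorem reindex (h : IsSpec A Q q) (e : n ≃ m) :
    IsSpec (Matrix.reindex e e A) (Q.submatrix e.symm id) q where
  left := by
    rw [conjTranspose_submatrix, submatrix_mul_equiv, h.left, submatrix_id_id]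
  right := by
    rw [conjTranspose_submatrix, ← submatrix_mul _ _ _ _ _ Function.bijective_id, h.right,
      submatrix_one_equiv]
  pos := h.pos
  eq := by rw [h.eq, spec_reindex]

end IsSpec

/-! ### Powers -/

theorem power_mul_power {A : Matrix n n ℂ} (hA : A.PosDef) (s t : ℝ) :
    power A s * power A t = power A (s + t) := by
  obtain ⟨Q, q, h⟩ := exists_isSpec hA
  rw [h.power_eq, h.power_eq, h.power_eq, spec_mul_spec h.left]
  simp only [Real.rpow_add (h.pos _)]

theorem power_zero {A : Matrix n n ℂ} (hA : A.PosDef) :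
    power A 0 = 1 := by
  obtain ⟨Q, q, h⟩ := exists_isSpec hA
  simp only [h.power_eq, Real.rpow_zero, spec_one h.right]

theorem power_one {A : Matrix n n ℂ} (hA : A.PosDef) :
    power A 1 = A := by
  obtain ⟨Q, q, h⟩ := exists_isSpec hA
  simp only [h.power_eq, Real.rpow_one]
  exact h.eq.symm

theorem power_neg_one {A : Matrix n n ℂ} (hA : A.PosDef) :
    power A (-1) = A⁻¹ := by
  obtain ⟨Q, q, h⟩ := exists_isSpec hA
  simp only [h.power_eq, h.inv_eq, Real.rpow_neg_one]

theorem power_conjTranspose {A : Matrix n n ℂ} (hA : A.PosDef) (s : ℝ) :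
    (power A s)ᴴ = power A s := by
  obtain ⟨Q, q, h⟩ := exists_isSpec hA
  rw [h.power_eq]
  exact spec_isHermitian _ _

theorem power_half_mul_self {A : Matrix n n ℂ} (hA : A.PosDef) :
    power A (1 / 2) * power A (1 / 2) = A := by
  rw [power_mul_power hA, add_halves, power_one hA]

/-! ### Coordinates in a pair of eigenbases -/

/-- The coordinates `Qᴴ X P` of the matrix `X`. -/
def coords (Q : Matrix n ι ℂ) (P : Matrix n κ ℂ) :
    Matrix n n ℂ →ₗ[ℂ] EuclideanSpace ℂ (ι × κ) where
  toFun X := WithLp.toLp 2 fun k => (Qᴴ * X * P) k.1 k.2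
  map_add' X Y := by ext k; simp [Matrix.mul_add, Matrix.add_mul]
  map_smul' c X := by ext k; simp

theorem coords_apply (Q : Matrix n ι ℂ) (P : Matrix n κ ℂ) (X : Matrix n n ℂ) (k : ι × κ) :
    coords Q P X k = (Qᴴ * X * P) k.1 k.2 := rfl

/-- The matrix with given coordinates. -/
def uncoords (Q : Matrix n ι ℂ) (P : Matrix n κ ℂ) :
    EuclideanSpace ℂ (ι × κ) →ₗ[ℂ] Matrix n n ℂ where
  toFun x := Q * Matrix.of (fun i j => x (i, j)) * Pᴴ
  map_add' x y := by
    rw [← Matrix.add_mul, ← Matrix.mul_add]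
    rfl
  map_smul' c x := by
    rw [RingHom.id_apply, ← Matrix.smul_mul, ← Matrix.mul_smul]
    rfl

variable {Q : Matrix n ι ℂ} {P : Matrix n κ ℂ}

theorem coords_uncoords (hQ : Qᴴ * Q = 1) (hP : Pᴴ * P = 1) (x : EuclideanSpace ℂ (ι × κ)) :
    coords Q P (uncoords Q P x) = x := by
  have : Qᴴ * (Q * Matrix.of (fun i j => x (i, j)) * Pᴴ) * P
      = (Qᴴ * Q) * Matrix.of (fun i j => x (i, j)) * (Pᴴ * P) := by simp only [Matrix.mul_assoc]
  ext k
  rw [coords_apply]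
  change (Qᴴ * (Q * Matrix.of (fun i j => x (i, j)) * Pᴴ) * P) k.1 k.2 = _
  rw [this, hQ, hP, Matrix.one_mul, Matrix.mul_one]
  rfl

theorem uncoords_coords (hQ : Q * Qᴴ = 1) (hP : P * Pᴴ = 1) (X : Matrix n n ℂ) :
    uncoords Q P (coords Q P X) = X := by
  change Q * (Qᴴ * X * P) * Pᴴ = X
  have : Q * (Qᴴ * X * P) * Pᴴ = (Q * Qᴴ) * X * (P * Pᴴ) := by simp only [Matrix.mul_assoc]
  rw [this, hQ, hP, Matrix.one_mul, Matrix.mul_one]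

/-- In these coordinates left and right multiplication by the two spectral matrices are
simultaneously diagonal, so the modular operator has eigenvalues `q i / p j`. -/
theorem sum_mul_norm_coords_sq (Q : Matrix n ι ℂ) (P : Matrix n κ ℂ) (f : ι → ℝ) (g : κ → ℝ)
    (X : Matrix n n ℂ) :
    ∑ k : ι × κ, f k.1 * g k.2 * ‖coords Q P X k‖ ^ 2
      = (Xᴴ * spec Q f * X * spec P g).trace.re := by
  set Y := Qᴴ * X * P with hY
  have h1 : (Xᴴ * spec Q f * X * spec P g).trace
      = (Yᴴ * diagonal (fun i => (f i : ℂ)) * Y * diagonal (fun i => (g i : ℂ))).trace := by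
    rw [spec, spec, ← Matrix.mul_assoc, trace_mul_comm, hY, conjTranspose_mul, conjTranspose_mul,
      conjTranspose_conjTranspose]
    simp only [Matrix.mul_assoc]
  rw [h1, trace, Complex.re_sum, Fintype.sum_prod_type_right]
  refine Finset.sum_congr rfl fun j _ => ?_
  rw [diag_apply, mul_diagonal, mul_apply, Finset.sum_mul, Complex.re_sum]
  refine Finset.sum_congr rfl fun i _ => ?_
  rw [mul_diagonal, conjTranspose_apply, coords_apply, ← hY, Complex.sq_norm,
    Complex.normSq_apply]
  simp
  ring

theorem inner_coords (hQ : Q * Qᴴ = 1) (hP : P * Pᴴ = 1) (X Y : Matrix n n ℂ) :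
    inner ℂ (coords Q P X) (coords Q P Y) = (Xᴴ * Y).trace := by
  have h1 : (Xᴴ * Y).trace = ((Qᴴ * X * P)ᴴ * (Qᴴ * Y * P)).trace := by
    have : (Qᴴ * X * P)ᴴ * (Qᴴ * Y * P) = Pᴴ * (Xᴴ * (Q * Qᴴ) * Y * P) := by
      rw [conjTranspose_mul, conjTranspose_mul, conjTranspose_conjTranspose]
      simp only [Matrix.mul_assoc]
    rw [this, hQ, trace_mul_comm (Pᴴ), Matrix.mul_one, Matrix.mul_assoc, hP, Matrix.mul_one]
  rw [h1, PiLp.inner_apply, trace, Fintype.sum_prod_type_right]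
  refine Finset.sum_congr rfl fun j _ => ?_
  rw [diag_apply, mul_apply]
  refine Finset.sum_congr rfl fun i _ => ?_
  rw [RCLike.inner_apply, conjTranspose_apply, coords_apply, coords_apply, mul_comm]
  rfl

theorem scale_coords (hQ : Qᴴ * Q = 1) (hP : Pᴴ * P = 1) (f : ι → ℝ) (g : κ → ℝ)
    (X : Matrix n n ℂ) :
    scale (coords Q P X) (fun k => f k.1 * g k.2) = coords Q P (spec Q f * X * spec P g) := by
  have h : Qᴴ * (spec Q f * X * spec P g) * P
      = diagonal (fun i => (f i : ℂ)) * (Qᴴ * X * P) * diagonal (fun i => (g i : ℂ)) := by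
    have : Qᴴ * (spec Q f * X * spec P g) * P
        = (Qᴴ * Q) * (diagonal (fun i => (f i : ℂ)) * (Qᴴ * X * P) * diagonal (fun i => (g i : ℂ)))
          * (Pᴴ * P) := by
      simp only [spec, Matrix.mul_assoc]
    rw [this, hQ, hP, Matrix.one_mul, Matrix.mul_one]
  ext k
  rw [scale_apply, coords_apply, coords_apply, h, mul_diagonal, diagonal_mul]
  push_cast
  ring

theorem hsNorm_sq (X : Matrix m n ℂ) : hsNorm X ^ 2 = ∑ i, ∑ j, ‖X i j‖ ^ 2 := by
  have h : hsNorm X = (∑ i, ∑ j, ‖X i j‖ ^ (2 : ℝ)) ^ (1 / 2 : ℝ) := frobenius_norm_def X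
  simp only [Real.rpow_two] at h
  rw [h, ← Real.sqrt_eq_rpow, Real.sq_sqrt]
  positivity

theorem hsNorm_nonneg (X : Matrix m n ℂ) : 0 ≤ hsNorm X := by
  have h : hsNorm X = (∑ i, ∑ j, ‖X i j‖ ^ (2 : ℝ)) ^ (1 / 2 : ℝ) := frobenius_norm_def X
  rw [h]
  positivity

theorem hsNorm_sq_eq_trace (X : Matrix n n ℂ) : hsNorm X ^ 2 = (Xᴴ * X).trace.re := by
  rw [hsNorm_sq, trace, Complex.re_sum, Finset.sum_comm]
  refine Finset.sum_congr rfl fun j _ => ?_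
  rw [diag_apply, mul_apply, Complex.re_sum]
  refine Finset.sum_congr rfl fun i _ => ?_
  rw [conjTranspose_apply, Complex.sq_norm, Complex.normSq_apply]
  simp

theorem norm_coords (hQ : Q * Qᴴ = 1) (hP : P * Pᴴ = 1) (X : Matrix n n ℂ) :
    ‖coords Q P X‖ = hsNorm X := by
  refine (pow_left_inj₀ (norm_nonneg _) (hsNorm_nonneg X) two_ne_zero).1 ?_
  rw [hsNorm_sq_eq_trace, ← inner_coords hQ hP, ← inner_self_eq_norm_sq (𝕜 := ℂ)]
  rfl

/-- The eigenvalues of the modular operator are at most its norm. -/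
theorem mul_inv_le_superNorm {A B : Matrix n n ℂ} {q : ι → ℝ} {p : κ → ℝ}
    (hA : IsSpec A Q q) (hB : IsSpec B P p) (k : ι × κ) :
    q k.1 * (p k.2)⁻¹ ≤ superNorm (modular A B) := by
  have hmod : ∀ X, coords Q P (modular A B X)
      = scale (coords Q P X) fun k => q k.1 * (p k.2)⁻¹ := by
    intro X
    rw [scale_coords hA.left hB.left q (fun j => (p j)⁻¹), ← hA.eq, ← hB.inv_eq, Matrix.mul_assoc]
    rfl
  have hpos : ∀ k : ι × κ, 0 < q k.1 * (p k.2)⁻¹ :=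
    fun k => mul_pos (hA.pos _) (inv_pos.2 (hB.pos _))
  -- The infimum is only meaningful over a nonempty set; the sum of all eigenvalues is a crude
  -- admissible bound.
  refine le_csInf ⟨∑ k : ι × κ, q k.1 * (p k.2)⁻¹, ?_, ?_⟩ ?_
  · exact Finset.sum_nonneg fun k _ => (hpos k).le
  · intro X
    rw [← norm_coords hA.right hB.right, ← norm_coords hA.right hB.right, hmod]
    refine norm_scale_le (Finset.sum_nonneg fun k _ => (hpos k).le) fun k => ?_
    rw [abs_of_pos (hpos k)]
    exact Finset.single_le_sum (f := fun k : ι × κ => q k.1 * (p k.2)⁻¹)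
      (fun k _ => (hpos k).le) (Finset.mem_univ k)
  · rintro C ⟨hC, h⟩
    -- Test on the eigenvector of the modular operator.
    have hk := h (uncoords Q P (EuclideanSpace.single k 1))
    rw [← norm_coords hA.right hB.right, ← norm_coords hA.right hB.right, hmod,
      coords_uncoords hA.left hB.left] at hk
    have : scale (EuclideanSpace.single k (1 : ℂ)) (fun k : ι × κ => q k.1 * (p k.2)⁻¹)
        = EuclideanSpace.single k ((q k.1 * (p k.2)⁻¹ : ℝ) : ℂ) := by
      ext j
      rw [scale_apply]
      by_cases hj : j = k
      · subst hj; simp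
      · simp [hj]
    rw [this, PiLp.norm_single, PiLp.norm_single, norm_one, mul_one,
      Complex.norm_real, Real.norm_of_nonneg (hpos k).le] at hk
    exact hk

end

/-! ### Relative entropy, modular contractions and stability of data processing. -/

section

open Matrix

variable {m n ι κ : Type*} [Fintype m] [DecidableEq m] [Fintype n] [DecidableEq n]
  [Fintype ι] [DecidableEq ι] [Fintype κ] [DecidableEq κ]

/-- The relative entropy `Tr ρ (log ρ - log σ)`. -/
def relEntropy (ρ σ : Matrix n n ℂ) : ℝ :=
  (ρ * cfc Real.log ρ).trace.re - (ρ * cfc Real.log σ).trace.re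

/-- This is `⟨ρ^(1/2), log Δ ρ^(1/2)⟩`: the logarithm of `q i / p j` splits, and each half reduces
to a trace against `ρ`. -/
theorem sum_norm_coords_sq_mul_log {ρ σ : Matrix n n ℂ} (hρ : ρ.PosDef) {Q : Matrix n ι ℂ}
    {q : ι → ℝ} {P : Matrix n κ ℂ} {p : κ → ℝ} (hσ : IsSpec σ Q q) (hP : IsSpec ρ P p) :
    ∑ k, ‖coords Q P (power ρ (1 / 2)) k‖ ^ 2 * Real.log (q k.1 * (p k.2)⁻¹)
      = -relEntropy ρ σ := by
  set v := power ρ (1 / 2) with hv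
  have hvt : vᴴ = v := power_conjTranspose hρ _
  have hvv : v * v = ρ := power_half_mul_self hρ
  have h1 := sum_mul_norm_coords_sq Q P (fun i => Real.log (q i)) (fun _ => 1) v
  have h2 := sum_mul_norm_coords_sq Q P (fun _ => 1) (fun j => Real.log (p j)) v
  rw [spec_one hP.right, Matrix.mul_one, ← hσ.cfc_eq, hvt, trace_mul_comm, ← Matrix.mul_assoc,
    hvv] at h1
  rw [spec_one hσ.right, Matrix.mul_one, ← hP.cfc_eq, hvt, hvv] at h2
  rw [relEntropy, neg_sub, ← h1, ← h2, ← Finset.sum_sub_distrib]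
  refine Finset.sum_congr rfl fun k _ => ?_
  rw [Real.log_mul (hσ.pos _).ne' (inv_ne_zero (hP.pos _).ne'), Real.log_inv]
  ring

/-- `U` is a contraction for the Hilbert-Schmidt norm that decreases the quadratic forms of the
modular operators, and its adjoint maps `ρ^(1/2)` to `ρ'^(1/2)`. -/
structure ModularContraction (ρ σ : Matrix n n ℂ) (ρ' σ' : Matrix m m ℂ)
    (U : Matrix m m ℂ →ₗ[ℂ] Matrix n n ℂ) : Prop where
  contraction : ∀ X, ((U X)ᴴ * U X).trace.re ≤ (Xᴴ * X).trace.re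
  form_le : ∀ X, ((U X)ᴴ * σ * U X * ρ⁻¹).trace.re ≤ (Xᴴ * σ' * X * ρ'⁻¹).trace.re
  dual : ∀ X, ((U X)ᴴ * power ρ (1 / 2)).trace.re = (Xᴴ * power ρ' (1 / 2)).trace.re
  trace_eq : ρ.trace.re = ρ'.trace.re

/-- A modular contraction that preserves the quadratic forms of the modular operators and maps
`ρ'^(1/2)` to `ρ^(1/2)`. -/
structure ModularEmbedding (ρ σ : Matrix n n ℂ) (ρ' σ' : Matrix m m ℂ)
    (U : Matrix m m ℂ →ₗ[ℂ] Matrix n n ℂ) : Prop extends ModularContraction ρ σ ρ' σ' U where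
  form_eq : ∀ X, ((U X)ᴴ * σ * U X * ρ⁻¹).trace.re = (Xᴴ * σ' * X * ρ'⁻¹).trace.re
  map_sqrt : U (power ρ' (1 / 2)) = power ρ (1 / 2)

namespace ModularContraction

variable {ρ σ : Matrix n n ℂ} {ρ' σ' : Matrix m m ℂ} {U : Matrix m m ℂ →ₗ[ℂ] Matrix n n ℂ}
  {ι' κ' : Type*} [Fintype ι'] [DecidableEq ι'] [Fintype κ'] [DecidableEq κ']
  {Q : Matrix n ι ℂ} {q : ι → ℝ} {P : Matrix n κ ℂ} {p : κ → ℝ}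
  {Q' : Matrix m ι' ℂ} {q' : ι' → ℝ} {P' : Matrix m κ' ℂ} {p' : κ' → ℝ}

theorem norm_coords_sqrt (hρ : ρ.PosDef) (hσ : IsSpec σ Q q) (hP : IsSpec ρ P p) :
    ‖coords Q P (power ρ (1 / 2))‖ ^ 2 = ρ.trace.re := by
  rw [norm_coords hσ.right hP.right, hsNorm_sq_eq_trace, power_conjTranspose hρ,
    power_half_mul_self hρ]

theorem sum_coords_modular (hσ : IsSpec σ Q q) (hP : IsSpec ρ P p) (X : Matrix n n ℂ) :
    ∑ k, q k.1 * (p k.2)⁻¹ * ‖coords Q P X k‖ ^ 2 = (Xᴴ * σ * X * ρ⁻¹).trace.re := by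
  rw [hP.inv_eq, hσ.eq]
  exact sum_mul_norm_coords_sq Q P q (fun j => (p j)⁻¹) X

/-- Bridge from matrices to the diagonal setting: `U` is read in eigenbases of the two modular
operators. -/
theorem subordinate (h : ModularContraction ρ σ ρ' σ' U) (hρ : ρ.PosDef) (hρ' : ρ'.PosDef)
    (hσ : IsSpec σ Q q) (hP : IsSpec ρ P p) (hσ' : IsSpec σ' Q' q') (hP' : IsSpec ρ' P' p') :
    Subordinate (fun k : ι × κ => q k.1 * (p k.2)⁻¹) (fun k : ι' × κ' => q' k.1 * (p' k.2)⁻¹)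
      (coords Q P ∘ₗ U ∘ₗ uncoords Q' P')
      (coords Q P (power ρ (1 / 2))) (coords Q' P' (power ρ' (1 / 2))) := by
  have hsurj : ∀ x, ∃ X, x = coords Q' P' X :=
    fun x => ⟨uncoords Q' P' x, (coords_uncoords hσ'.left hP'.left x).symm⟩
  have hU : ∀ X, (coords Q P ∘ₗ U ∘ₗ uncoords Q' P') (coords Q' P' X) = coords Q P (U X) := by
    intro X
    simp only [LinearMap.comp_apply, uncoords_coords hσ'.right hP'.right]
  refine ⟨fun k => mul_pos (hσ.pos _) (inv_pos.2 (hP.pos _)),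
    fun k => mul_pos (hσ'.pos _) (inv_pos.2 (hP'.pos _)), fun x => ?_, fun x => ?_, fun x => ?_, ?_⟩
  · obtain ⟨X, rfl⟩ := hsurj x
    rw [hU, norm_coords hσ.right hP.right, norm_coords hσ'.right hP'.right]
    refine (pow_le_pow_iff_left₀ (hsNorm_nonneg _) (hsNorm_nonneg _) two_ne_zero).1 ?_
    rw [hsNorm_sq_eq_trace, hsNorm_sq_eq_trace]
    exact h.contraction X
  · obtain ⟨X, rfl⟩ := hsurj x
    rw [hU, sum_coords_modular hσ hP, sum_coords_modular hσ' hP']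
    exact h.form_le X
  · obtain ⟨X, rfl⟩ := hsurj x
    rw [hU, inner_coords hσ.right hP.right, inner_coords hσ'.right hP'.right]
    exact h.dual X
  · refine (pow_left_inj₀ (norm_nonneg _) (norm_nonneg _) two_ne_zero).1 ?_
    rw [norm_coords_sqrt hρ hσ hP, norm_coords_sqrt hρ' hσ' hP', h.trace_eq]

/-- Data processing inequality. -/
theorem relEntropy_le (h : ModularContraction ρ σ ρ' σ' U) (hρ : ρ.PosDef) (hσ : σ.PosDef)
    (hρ' : ρ'.PosDef) (hσ' : σ'.PosDef) : relEntropy ρ' σ' ≤ relEntropy ρ σ := by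
  obtain ⟨P, p, hP⟩ := exists_isSpec hρ
  obtain ⟨Q, q, hQ⟩ := exists_isSpec hσ
  obtain ⟨P', p', hP'⟩ := exists_isSpec hρ'
  obtain ⟨Q', q', hQ'⟩ := exists_isSpec hσ'
  have := (h.subordinate hρ hρ' hQ hP hQ' hP').deficit_nonneg
  rw [sum_norm_coords_sq_mul_log hρ hQ hP, sum_norm_coords_sq_mul_log hρ' hQ' hP'] at this
  linarith

theorem scale_coords_power (hρ : ρ.PosDef) (hσ : IsSpec σ Q q) (hP : IsSpec ρ P p) (β : ℝ) :
    scale (coords Q P (power ρ (1 / 2))) (fun k => (q k.1 * (p k.2)⁻¹) ^ β)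
      = coords Q P (power σ β * power ρ (1 / 2 - β)) := by
  have h1 : (fun k : ι × κ => (q k.1 * (p k.2)⁻¹) ^ β)
      = fun k => q k.1 ^ β * p k.2 ^ (-β) := by
    funext k
    rw [Real.mul_rpow (hσ.pos _).le (inv_nonneg.2 (hP.pos _).le), Real.inv_rpow (hP.pos _).le,
      Real.rpow_neg (hP.pos _).le]
  rw [h1, scale_coords hσ.left hP.left (fun i => q i ^ β) (fun j => p j ^ (-β)), ← hσ.power_eq,
    ← hP.power_eq, Matrix.mul_assoc, power_mul_power hρ, sub_eq_add_neg]

end ModularContraction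

namespace ModularEmbedding

variable {ρ σ : Matrix n n ℂ} {ρ' σ' : Matrix m m ℂ} {U : Matrix m m ℂ →ₗ[ℂ] Matrix n n ℂ}
  {ι' κ' : Type*} [Fintype ι'] [DecidableEq ι'] [Fintype κ'] [DecidableEq κ']
  {Q : Matrix n ι ℂ} {q : ι → ℝ} {P : Matrix n κ ℂ} {p : κ → ℝ}
  {Q' : Matrix m ι' ℂ} {q' : ι' → ℝ} {P' : Matrix m κ' ℂ} {p' : κ' → ℝ}

theorem mu_le (h : ModularEmbedding ρ σ ρ' σ' U) (hρ : ρ.PosDef) (hρ' : ρ'.PosDef)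
    (hσ : IsSpec σ Q q) (hP : IsSpec ρ P p) (hσ' : IsSpec σ' Q' q') (hP' : IsSpec ρ' P' p')
    {L : ℝ} (hL : ∀ k : ι × κ, q k.1 * (p k.2)⁻¹ ≤ L) (k : ι' × κ') :
    q' k.1 * (p' k.2)⁻¹ ≤ L := by
  refine (h.subordinate hρ hρ' hσ hP hσ' hP').mu_le (fun x => ?_) hL k
  obtain ⟨X, rfl⟩ : ∃ X, x = coords Q' P' X :=
    ⟨uncoords Q' P' x, (coords_uncoords hσ'.left hP'.left x).symm⟩
  simp only [LinearMap.comp_apply, uncoords_coords hσ'.right hP'.right]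
  rw [ModularContraction.sum_coords_modular hσ hP, ModularContraction.sum_coords_modular hσ' hP',
    h.form_eq]

theorem norm_scale_sub (hρ : ρ.PosDef) (hρ' : ρ'.PosDef)
    (hσ : IsSpec σ Q q) (hP : IsSpec ρ P p) (hσ' : IsSpec σ' Q' q') (hP' : IsSpec ρ' P' p')
    (β : ℝ) :
    ‖(coords Q P ∘ₗ U ∘ₗ uncoords Q' P')
        (scale (coords Q' P' (power ρ' (1 / 2))) fun k => (q' k.1 * (p' k.2)⁻¹) ^ β)
      - scale (coords Q P (power ρ (1 / 2))) (fun k => (q k.1 * (p k.2)⁻¹) ^ β)‖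
      = hsNorm (U (power σ' β * power ρ' (1 / 2 - β)) - power σ β * power ρ (1 / 2 - β)) := by
  rw [ModularContraction.scale_coords_power hρ hσ hP,
    ModularContraction.scale_coords_power hρ' hσ' hP']
  simp only [LinearMap.comp_apply, uncoords_coords hσ'.right hP'.right]
  rw [← map_sub, norm_coords hσ.right hP.right]

theorem map_coords_sqrt (h : ModularEmbedding ρ σ ρ' σ' U)
    (hσ' : IsSpec σ' Q' q') (hP' : IsSpec ρ' P' p') :
    (coords Q P ∘ₗ U ∘ₗ uncoords Q' P') (coords Q' P' (power ρ' (1 / 2)))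
      = coords Q P (power ρ (1 / 2)) := by
  simp only [LinearMap.comp_apply, uncoords_coords hσ'.right hP'.right, h.map_sqrt]

theorem norm_coords_sqrt_eq_one (h : ModularEmbedding ρ σ ρ' σ' U) (hρ' : ρ'.PosDef)
    (htr : ρ.trace.re = 1) (hσ' : IsSpec σ' Q' q') (hP' : IsSpec ρ' P' p') :
    ‖coords Q' P' (power ρ' (1 / 2))‖ = 1 := by
  refine (pow_left_inj₀ (norm_nonneg _) zero_le_one two_ne_zero).1 ?_
  rw [ModularContraction.norm_coords_sqrt hρ' hσ' hP', ← h.trace_eq, htr, one_pow]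

/-- Stability of the data processing inequality. -/
theorem constN_mul_le (h : ModularEmbedding ρ σ ρ' σ' U) (hρ : ρ.PosDef) (hσ : σ.PosDef)
    (hρ' : ρ'.PosDef) (hσ' : σ'.PosDef) (htr : ρ.trace.re = 1) {β : ℝ} (h0 : 0 < β) (h1 : β < 1) :
    constN β (superNorm (modular σ ρ))
        * hsNorm (U (power σ' β * power ρ' (1 / 2 - β)) - power σ β * power ρ (1 / 2 - β))
          ^ (1 / alpha β)
      ≤ relEntropy ρ σ - relEntropy ρ' σ' := by
  obtain ⟨P, p, hP⟩ := exists_isSpec hρ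
  obtain ⟨Q, q, hQ⟩ := exists_isSpec hσ
  obtain ⟨P', p', hP'⟩ := exists_isSpec hρ'
  obtain ⟨Q', q', hQ'⟩ := exists_isSpec hσ'
  have hle := mul_inv_le_superNorm hQ hP
  have hnn : 0 ≤ superNorm (modular σ ρ) := Real.sInf_nonneg fun C hC => hC.1
  have := (h.subordinate hρ hρ' hQ hP hQ' hP').constN_mul_le
    (h.map_coords_sqrt hQ' hP') (h.norm_coords_sqrt_eq_one hρ' htr hQ' hP') h0 h1 hnn hle
    (h.mu_le hρ hρ' hQ hP hQ' hP' hle)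
  rw [norm_scale_sub hρ hρ' hQ hP hQ' hP', sum_norm_coords_sq_mul_log hρ hQ hP,
    sum_norm_coords_sq_mul_log hρ' hQ' hP'] at this
  linarith

theorem inv_le_opNorm_inv (hP : IsSpec ρ P p) (j : κ) : (p j)⁻¹ ≤ opNorm ρ⁻¹ := by
  have h1 : ρ⁻¹ * P = P * diagonal fun i => (((p i)⁻¹ : ℝ) : ℂ) := by
    rw [hP.inv_eq, spec, Matrix.mul_assoc, hP.left, Matrix.mul_one]
  set x : EuclideanSpace ℂ n := WithLp.toLp 2 (fun i => P i j) with hx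
  have hxn : ‖x‖ ^ 2 = 1 := by
    have h2 : (Pᴴ * P) j j = 1 := by rw [hP.left, one_apply_eq]
    rw [mul_apply] at h2
    have h3 := congrArg Complex.re h2
    rw [Complex.re_sum, Complex.one_re] at h3
    rw [EuclideanSpace.norm_sq_eq, ← h3]
    refine Finset.sum_congr rfl fun i _ => ?_
    rw [conjTranspose_apply, Complex.sq_norm, Complex.normSq_apply]
    simp [hx]
  have hxn : ‖x‖ = 1 :=
    (pow_left_inj₀ (norm_nonneg _) zero_le_one two_ne_zero).1 (hxn.trans (one_pow 2).symm)
  have h4 := l2_opNorm_mulVec ρ⁻¹ x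
  have h5 : (EuclideanSpace.equiv n ℂ).symm (ρ⁻¹.mulVec x.ofLp) = (((p j)⁻¹ : ℝ) : ℂ) • x := by
    ext i
    have h6 := congrFun (congrFun h1 i) j
    rw [mul_diagonal, mul_comm] at h6
    exact h6
  rw [h5, norm_smul, hxn, mul_one, mul_one, Complex.norm_real,
    Real.norm_of_nonneg (inv_pos.2 (hP.pos j)).le] at h4
  exact h4

theorem eigenvalue_le_one (hσ : IsSpec σ Q q) (htr : σ.trace.re = 1) (i : ι) : q i ≤ 1 := by
  rw [hσ.eq, trace_spec hσ.left, Complex.ofReal_re] at htr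
  rw [← htr]
  exact Finset.single_le_sum (fun i _ => (hσ.pos i).le) (Finset.mem_univ i)

/-- Since `σ` has trace one, its eigenvalues are at most one, and those of the modular operator are
at most `‖ρ⁻¹‖`. At `β = 1/2` the remaining powers of `ρ` and `ρ'` are trivial. -/
theorem half_pow_four_le (h : ModularEmbedding ρ σ ρ' σ' U) (hρ : ρ.PosDef) (hσ : σ.PosDef)
    (hρ' : ρ'.PosDef) (hσ' : σ'.PosDef) (htr : ρ.trace.re = 1) (htr' : σ.trace.re = 1) :
    (Real.pi / 4) ^ 4 * hsNorm (U (power σ' (1 / 2)) - power σ (1 / 2)) ^ 4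
      ≤ opNorm ρ⁻¹ ^ 2 * (relEntropy ρ σ - relEntropy ρ' σ') ∧ 0 < opNorm ρ⁻¹ := by
  obtain ⟨P, p, hP⟩ := exists_isSpec hρ
  obtain ⟨Q, q, hQ⟩ := exists_isSpec hσ
  obtain ⟨P', p', hP'⟩ := exists_isSpec hρ'
  obtain ⟨Q', q', hQ'⟩ := exists_isSpec hσ'
  have hpos : 0 < opNorm ρ⁻¹ := by
    rcases isEmpty_or_nonempty n with hn | ⟨⟨j⟩⟩
    · simp [trace] at htr
    · exact (inv_pos.2 (hP.pos j)).trans_le (inv_le_opNorm_inv hP j)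
  have hle : ∀ k : n × n, q k.1 * (p k.2)⁻¹ ≤ opNorm ρ⁻¹ := fun k =>
    (mul_le_of_le_one_left (inv_pos.2 (hP.pos _)).le (eigenvalue_le_one hQ htr' _)).trans
      (inv_le_opNorm_inv hP _)
  have := (h.subordinate hρ hρ' hQ hP hQ' hP').half_pow_four_le
    (h.map_coords_sqrt hQ' hP') (h.norm_coords_sqrt_eq_one hρ' htr hQ' hP') hpos hle
    (h.mu_le hρ hρ' hQ hP hQ' hP' hle)
  rw [norm_scale_sub hρ hρ' hQ hP hQ' hP', sum_norm_coords_sq_mul_log hρ hQ hP,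
    sum_norm_coords_sq_mul_log hρ' hQ' hP', sub_self, power_zero hρ, power_zero hρ',
    Matrix.mul_one, Matrix.mul_one] at this
  exact ⟨this.trans_eq (by ring), hpos⟩

end ModularEmbedding

end

section

open Matrix

variable {m n : Type*} [Fintype m] [DecidableEq m] [Fintype n]
  [DecidableEq n]

/-! ### The trace norm -/

theorem hsNorm_mul_unitary {Q : Matrix n n ℂ} (hQ : Q * Qᴴ = 1) (X : Matrix n n ℂ) :
    hsNorm (X * Q) = hsNorm X := by
  refine (pow_left_inj₀ (hsNorm_nonneg _) (hsNorm_nonneg _) two_ne_zero).1 ?_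
  rw [hsNorm_sq_eq_trace, hsNorm_sq_eq_trace, conjTranspose_mul, trace_mul_comm,
    ← Matrix.mul_assoc, Matrix.mul_assoc X, hQ, Matrix.mul_one, trace_mul_comm]

theorem traceNorm_spec {Q : Matrix n n ℂ} (hQ : Qᴴ * Q = 1) (hQ' : Q * Qᴴ = 1) (q : n → ℝ) :
    traceNorm (spec Q q) = ∑ i, |q i| := by
  rw [traceNorm, (spec_isHermitian Q q).eq, spec_mul_spec hQ, cfc_spec hQ hQ', trace_spec hQ,
    Complex.ofReal_re]
  simp only [← sq, Real.sqrt_sq_eq_abs]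

theorem traceNorm_eq_zero {M : Matrix n n ℂ} (hM : M.IsHermitian) (h : traceNorm M = 0) :
    M = 0 := by
  have hs := hM.eq_spec
  rw [hs, traceNorm_spec (Unitary.coe_star_mul_self _) (Unitary.coe_mul_star_self _),
    Finset.sum_eq_zero_iff_of_nonneg fun i _ => abs_nonneg _] at h
  have h0 : hM.eigenvalues = fun _ => 0 := funext fun i => abs_eq_zero.1 (h i (Finset.mem_univ i))
  rw [hs, h0, spec]
  simp

theorem sum_norm_mul_norm_le (X Y : Matrix n n ℂ) :
    ∑ i, ∑ j, ‖X i j‖ * ‖Y i j‖ ≤ hsNorm X * hsNorm Y := by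
  have h := Finset.sum_mul_sq_le_sq_mul_sq (Finset.univ : Finset (n × n))
    (fun k => ‖X k.1 k.2‖) (fun k => ‖Y k.1 k.2‖)
  simp only [Fintype.sum_prod_type, ← hsNorm_sq] at h
  rw [← mul_pow] at h
  exact abs_le_of_sq_le_sq' h (mul_nonneg (hsNorm_nonneg X) (hsNorm_nonneg Y)) |>.2

/-- In an eigenbasis of the difference, each eigenvalue is a sum of terms `|y|² - |z|²`. Factor
these, use `||y| - |z|| ≤ |y - z|`, and apply Cauchy–Schwarz. -/
theorem traceNorm_sub_le (Y Z : Matrix n n ℂ) :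
    traceNorm (Yᴴ * Y - Zᴴ * Z) ≤ hsNorm (Y - Z) * (hsNorm Y + hsNorm Z) := by
  have hM : (Yᴴ * Y - Zᴴ * Z).IsHermitian :=
    (isHermitian_conjTranspose_mul_self Y).sub (isHermitian_conjTranspose_mul_self Z)
  set Q : Matrix n n ℂ := (hM.eigenvectorUnitary : Matrix n n ℂ) with hQdef
  have hQ : Qᴴ * Q = 1 := Unitary.coe_star_mul_self _
  have hQ' : Q * Qᴴ = 1 := Unitary.coe_mul_star_self _
  have hs : Yᴴ * Y - Zᴴ * Z = spec Q hM.eigenvalues := hM.eq_spec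
  have hdiag : diagonal (fun i => (hM.eigenvalues i : ℂ))
      = (Y * Q)ᴴ * (Y * Q) - (Z * Q)ᴴ * (Z * Q) := by
    have e : Qᴴ * (Yᴴ * Y - Zᴴ * Z) * Q = (Y * Q)ᴴ * (Y * Q) - (Z * Q)ᴴ * (Z * Q) := by
      simp only [conjTranspose_mul, Matrix.mul_sub, Matrix.sub_mul, Matrix.mul_assoc]
    have h1 : Qᴴ * spec Q hM.eigenvalues * Q = diagonal (fun i => (hM.eigenvalues i : ℂ)) := by
      have : Qᴴ * spec Q hM.eigenvalues * Q
          = (Qᴴ * Q) * diagonal (fun i => (hM.eigenvalues i : ℂ)) * (Qᴴ * Q) := by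
        simp only [spec, Matrix.mul_assoc]
      rw [this, hQ, Matrix.one_mul, Matrix.mul_one]
    exact h1.symm.trans ((congrArg (fun M => Qᴴ * M * Q) hs.symm).trans e)
  have hev : ∀ i, hM.eigenvalues i = ∑ k, (‖(Y * Q) k i‖ ^ 2 - ‖(Z * Q) k i‖ ^ 2) := by
    intro i
    have := congrArg Complex.re (congrFun (congrFun hdiag i) i)
    rw [diagonal_apply_eq, Complex.ofReal_re, Matrix.sub_apply, mul_apply, mul_apply, Complex.sub_re,
      Complex.re_sum, Complex.re_sum, ← Finset.sum_sub_distrib] at this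
    rw [this]
    refine Finset.sum_congr rfl fun k _ => ?_
    rw [conjTranspose_apply, conjTranspose_apply, Complex.sq_norm, Complex.sq_norm,
      Complex.normSq_apply, Complex.normSq_apply]
    simp
  rw [hs, traceNorm_spec hQ hQ', ← hsNorm_mul_unitary hQ' Y, ← hsNorm_mul_unitary hQ' Z,
    ← hsNorm_mul_unitary hQ' (Y - Z), mul_add]
  refine le_trans ?_ (add_le_add (sum_norm_mul_norm_le _ _) (sum_norm_mul_norm_le _ _))
  rw [← Finset.sum_add_distrib, Finset.sum_congr rfl fun k _ => Finset.sum_add_distrib.symm,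
    Finset.sum_comm]
  refine Finset.sum_le_sum fun i _ => ?_
  rw [hev]
  refine (Finset.abs_sum_le_sum_abs _ _).trans (Finset.sum_le_sum fun k _ => ?_)
  rw [sq_sub_sq, abs_mul, abs_of_nonneg (by positivity), Matrix.sub_mul, Matrix.sub_apply, ← mul_add,
    mul_comm]
  gcongr
  exact abs_norm_sub_norm_le _ _

/-! ### Partial traces -/

theorem ampl_mul (X Y : Matrix n n ℂ) :
    (ampl (X * Y) : Matrix (m × n) (m × n) ℂ) = ampl X * ampl Y := by
  rw [ampl, ampl, ampl, ← mul_kronecker_mul, Matrix.one_mul]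

theorem ampl_one : (ampl (1 : Matrix n n ℂ) : Matrix (m × n) (m × n) ℂ) = 1 := one_kronecker_one

theorem ampl_conjTranspose (X : Matrix n n ℂ) :
    (ampl X : Matrix (m × n) (m × n) ℂ)ᴴ = ampl Xᴴ := by
  rw [ampl, conjTranspose_kronecker, conjTranspose_one, ampl]

theorem traceFst_add (M N : Matrix (m × n) (m × n) ℂ) :
    traceFst (M + N) = traceFst M + traceFst N := by
  ext j k
  simp [traceFst, Finset.sum_add_distrib]

theorem traceFst_smul (c : ℂ) (M : Matrix (m × n) (m × n) ℂ) :
    traceFst (c • M) = c • traceFst M := by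
  ext j k
  simp [traceFst, Finset.mul_sum]

theorem traceFst_mul_ampl (M : Matrix (m × n) (m × n) ℂ) (X : Matrix n n ℂ) :
    traceFst (M * ampl X) = traceFst M * X := by
  ext j k
  simp only [traceFst, of_apply, mul_apply, ampl, kronecker_apply, Fintype.sum_prod_type,
    one_apply, ite_mul, one_mul, zero_mul, mul_ite, mul_zero, Finset.sum_mul]
  rw [Finset.sum_comm (s := Finset.univ (α := n))]
  refine Finset.sum_congr rfl fun i _ => ?_
  rw [Finset.sum_comm]
  simp

theorem traceFst_conjTranspose (M : Matrix (m × n) (m × n) ℂ) :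
    traceFst Mᴴ = (traceFst M)ᴴ := by
  ext j k
  simp [traceFst, conjTranspose_apply]

theorem traceFst_ampl_mul (M : Matrix (m × n) (m × n) ℂ) (X : Matrix n n ℂ) :
    traceFst (ampl X * M) = X * traceFst M := by
  rw [← conjTranspose_inj, ← traceFst_conjTranspose, conjTranspose_mul, ampl_conjTranspose,
    traceFst_mul_ampl, traceFst_conjTranspose, conjTranspose_mul]

theorem trace_traceFst (M : Matrix (m × n) (m × n) ℂ) : (traceFst M).trace = M.trace := by
  simp only [trace, traceFst, diag_apply, of_apply, Fintype.sum_prod_type]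
  rw [Finset.sum_comm]

theorem trace_mul_ampl (M : Matrix (m × n) (m × n) ℂ) (X : Matrix n n ℂ) :
    (M * ampl X).trace = (traceFst M * X).trace := by
  rw [← traceFst_mul_ampl, trace_traceFst]

theorem trace_ampl_mul (M : Matrix (m × n) (m × n) ℂ) (X : Matrix n n ℂ) :
    (ampl X * M).trace = (X * traceFst M).trace := by
  rw [← traceFst_ampl_mul, trace_traceFst]

theorem traceFst_posDef [Nonempty m] {M : Matrix (m × n) (m × n) ℂ} (hM : M.PosDef) :
    (traceFst M).PosDef := by
  have h : traceFst M = ∑ i, M.submatrix (fun j => (i, j)) (fun j => (i, j)) := by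
    ext j k
    simp [traceFst, Matrix.sum_apply]
  have hp : ∀ i : m, (M.submatrix (fun j => (i, j)) (fun j => (i, j))).PosDef :=
    fun i => hM.submatrix (Prod.mk_right_injective i)
  rw [h]
  exact Finset.sum_induction_nonempty _ _ (fun _ _ => PosDef.add) Finset.univ_nonempty
    fun i _ => hp i

/-! ### The embedding attached to a partial trace -/

variable {ρ σ : Matrix (m × n) (m × n) ℂ}

theorem power_half_mul_inv {A : Matrix n n ℂ} (hA : A.PosDef) :
    power A (1 / 2) * A⁻¹ = power A (-(1 / 2)) := by
  rw [← power_neg_one hA, power_mul_power hA]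
  norm_num

theorem power_neg_half_mul_self {A : Matrix n n ℂ} (hA : A.PosDef) :
    power A (-(1 / 2)) * power A (-(1 / 2)) = A⁻¹ := by
  rw [← power_neg_one hA, power_mul_power hA]
  norm_num

theorem power_half_mul_neg_half {A : Matrix n n ℂ} (hA : A.PosDef) :
    power A (1 / 2) * power A (-(1 / 2)) = 1 := by
  rw [power_mul_power hA, ← power_zero hA]
  norm_num

theorem power_neg_half_mul_half {A : Matrix n n ℂ} (hA : A.PosDef) :
    power A (-(1 / 2)) * power A (1 / 2) = 1 := by
  rw [power_mul_power hA, ← power_zero hA]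
  norm_num

theorem power_neg_half_mul_mul_neg_half {A : Matrix n n ℂ} (hA : A.PosDef) :
    power A (-(1 / 2)) * A * power A (-(1 / 2)) = 1 := by
  have h : power A (-(1 / 2)) * A * power A (-(1 / 2)) = power A (-(1 / 2))
      * (power A (1 / 2) * power A (1 / 2)) * power A (-(1 / 2)) := by
    rw [power_half_mul_self hA]
  rw [h, ← Matrix.mul_assoc, power_neg_half_mul_half hA, Matrix.one_mul,
    power_half_mul_neg_half hA]

theorem mul_power_neg_half {A : Matrix n n ℂ} (hA : A.PosDef) :
    A * power A (-(1 / 2)) = power A (1 / 2) := by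
  have h : A * power A (-(1 / 2)) = power A (1 / 2) * power A (1 / 2) * power A (-(1 / 2)) := by
    rw [power_half_mul_self hA]
  rw [h, Matrix.mul_assoc, power_half_mul_neg_half hA, Matrix.mul_one]

/-- The isometry `X ↦ (I ⊗ X ρ₁^(-1/2)) ρ^(1/2)`. -/
def embedding (ρ : Matrix (m × n) (m × n) ℂ) :
    Matrix n n ℂ →ₗ[ℂ] Matrix (m × n) (m × n) ℂ where
  toFun X := ampl (X * power (traceFst ρ) (-(1 / 2))) * power ρ (1 / 2)
  map_add' X Y := by rw [Matrix.add_mul, ampl, kronecker_add, Matrix.add_mul]; rfl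
  map_smul' c X := by rw [Matrix.smul_mul, ampl, kronecker_smul, Matrix.smul_mul]; rfl

theorem embedding_apply (ρ : Matrix (m × n) (m × n) ℂ) (X : Matrix n n ℂ) :
    embedding ρ X = ampl (X * power (traceFst ρ) (-(1 / 2))) * power ρ (1 / 2) := rfl

theorem embedding_conjTranspose (hρ : ρ.PosDef) (hρ' : (traceFst ρ).PosDef) (X : Matrix n n ℂ) :
    (embedding ρ X)ᴴ = power ρ (1 / 2) * ampl (power (traceFst ρ) (-(1 / 2)) * Xᴴ) := by
  rw [embedding_apply, conjTranspose_mul, power_conjTranspose hρ, ampl_conjTranspose,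
    conjTranspose_mul, power_conjTranspose hρ']

theorem modularEmbedding_embedding (hρ : ρ.PosDef) (hρ' : (traceFst ρ).PosDef) :
    ModularEmbedding ρ σ (traceFst ρ) (traceFst σ) (embedding ρ) := by
  set R := power ρ (1 / 2) with hR
  set r := power (traceFst ρ) (-(1 / 2)) with hr
  have hform : ∀ X, ((embedding ρ X)ᴴ * σ * embedding ρ X * ρ⁻¹).trace
      = (Xᴴ * traceFst σ * X * (traceFst ρ)⁻¹).trace := by
    intro X
    rw [embedding_conjTranspose hρ hρ', embedding_apply, ← hR, ← hr]
    calc (R * ampl (r * Xᴴ) * σ * (ampl (X * r) * R) * ρ⁻¹).trace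
        = (R * (ampl (r * Xᴴ) * (σ * ampl (X * r))) * (R * ρ⁻¹)).trace := by
          simp only [Matrix.mul_assoc]
      _ = (ampl (r * Xᴴ) * (σ * ampl (X * r))).trace := by
          rw [power_half_mul_inv hρ, trace_mul_comm, ← Matrix.mul_assoc,
            power_neg_half_mul_half hρ, Matrix.one_mul]
      _ = (r * (Xᴴ * traceFst σ * X * r)).trace := by
          rw [trace_ampl_mul, traceFst_mul_ampl]
          simp only [Matrix.mul_assoc]
      _ = (Xᴴ * traceFst σ * X * (traceFst ρ)⁻¹).trace := by
          rw [trace_mul_comm, Matrix.mul_assoc _ r, power_neg_half_mul_self hρ']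
  have hcon : ∀ X, ((embedding ρ X)ᴴ * embedding ρ X).trace = (Xᴴ * X).trace := by
    intro X
    rw [embedding_conjTranspose hρ hρ', embedding_apply, ← hR, ← hr]
    calc (R * ampl (r * Xᴴ) * (ampl (X * r) * R)).trace
        = (R * (ampl (r * Xᴴ * (X * r)) * R)).trace := by
          rw [ampl_mul (r * Xᴴ)]
          simp only [Matrix.mul_assoc]
      _ = (r * (Xᴴ * X * (r * traceFst ρ))).trace := by
          rw [trace_mul_comm, Matrix.mul_assoc, power_half_mul_self hρ, trace_ampl_mul]
          simp only [Matrix.mul_assoc]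
      _ = (Xᴴ * X).trace := by
          rw [trace_mul_comm, Matrix.mul_assoc, hr, power_neg_half_mul_mul_neg_half hρ',
            Matrix.mul_one]
  refine ⟨⟨fun X => (congrArg Complex.re (hcon X)).le, fun X => (congrArg Complex.re (hform X)).le,
    fun X => congrArg Complex.re ?_, congrArg Complex.re (trace_traceFst ρ).symm⟩,
    fun X => congrArg Complex.re (hform X), ?_⟩
  · rw [embedding_conjTranspose hρ hρ', trace_mul_comm, ← Matrix.mul_assoc,
      power_half_mul_self hρ, trace_mul_ampl, ← Matrix.mul_assoc, trace_mul_comm,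
      mul_power_neg_half hρ']
  · rw [embedding_apply, power_half_mul_neg_half hρ', ampl_one, Matrix.one_mul]

/-- It exhibits the recovered operator as `Y* Y` with `Y = U γ^(1/2)`, the form needed by
`traceNorm_sub_le`. -/
theorem petz_eq (hρ : ρ.PosDef) (hρ' : (traceFst ρ).PosDef) {γ : Matrix n n ℂ} (hγ : γ.PosDef) :
    petz ρ γ = (embedding ρ (power γ (1 / 2)))ᴴ * embedding ρ (power γ (1 / 2)) := by
  rw [embedding_conjTranspose hρ hρ', embedding_apply, petz, power_conjTranspose hγ]
  have : power (traceFst ρ) (-(1 / 2)) * γ * power (traceFst ρ) (-(1 / 2))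
      = power (traceFst ρ) (-(1 / 2)) * power γ (1 / 2)
        * (power γ (1 / 2) * power (traceFst ρ) (-(1 / 2))) := by
    rw [Matrix.mul_assoc _ (power γ (1 / 2)), ← Matrix.mul_assoc (power γ (1 / 2)),
      power_half_mul_self hγ, Matrix.mul_assoc]
  rw [this, ampl_mul]
  simp only [Matrix.mul_assoc]

theorem isHermitian_petz (hρ : ρ.PosDef) (hρ' : (traceFst ρ).PosDef) {γ : Matrix n n ℂ}
    (hγ : γ.PosDef) : (petz ρ γ).IsHermitian := by
  rw [petz_eq hρ hρ' hγ]
  exact isHermitian_conjTranspose_mul_self _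

theorem trace_petz (hρ : ρ.PosDef) (hρ' : (traceFst ρ).PosDef) (γ : Matrix n n ℂ) :
    (petz ρ γ).trace = γ.trace := by
  rw [petz, trace_mul_comm, ← Matrix.mul_assoc, power_half_mul_self hρ, trace_mul_ampl,
    ← Matrix.mul_assoc, ← Matrix.mul_assoc, mul_power_neg_half hρ', trace_mul_comm,
    ← Matrix.mul_assoc, power_neg_half_mul_half hρ', Matrix.one_mul]

/-! ### The contraction attached to the recovery map -/

theorem trace_conjTranspose_mul_self_nonneg (E : Matrix n n ℂ) : 0 ≤ (Eᴴ * E).trace.re := by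
  rw [← hsNorm_sq_eq_trace]
  positivity

/-- Monotonicity of `(Y, ρ) ↦ Tr Yᴴ Y ρ⁻¹` under the partial trace. -/
theorem trace_traceFst_mul_inv_le (hρ : ρ.PosDef) (hρ' : (traceFst ρ).PosDef)
    (Y : Matrix (m × n) (m × n) ℂ) :
    ((traceFst Y)ᴴ * traceFst Y * (traceFst ρ)⁻¹).trace.re ≤ (Yᴴ * Y * ρ⁻¹).trace.re := by
  set T := traceFst Y with hT
  set K := T * (traceFst ρ)⁻¹ with hK
  have hKt : Kᴴ = (traceFst ρ)⁻¹ * Tᴴ := by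
    rw [hK, conjTranspose_mul, hρ'.isHermitian.inv.eq]
  set R := power ρ (1 / 2) with hR
  set r := power ρ (-(1 / 2)) with hr
  have hRt : Rᴴ = R := power_conjTranspose hρ _
  have hrt : rᴴ = r := power_conjTranspose hρ _
  have hRR : R * R = ρ := power_half_mul_self hρ
  have hrr : r * r = ρ⁻¹ := power_neg_half_mul_self hρ
  have hRr : R * r = 1 := power_half_mul_neg_half hρ
  have hrR : r * R = 1 := power_neg_half_mul_half hρ
  -- A completed square: `K` is chosen so that both cross terms and the last square all equal the
  -- left side of the claim.
  have h := trace_conjTranspose_mul_self_nonneg (Y * r - ampl K * R)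
  have t1 : ((Y * r)ᴴ * (Y * r)).trace = (Yᴴ * Y * ρ⁻¹).trace := by
    rw [conjTranspose_mul, hrt, Matrix.mul_assoc, trace_mul_comm, Matrix.mul_assoc,
      Matrix.mul_assoc, hrr, Matrix.mul_assoc]
  have t2 : ((Y * r)ᴴ * (ampl K * R)).trace = (Tᴴ * T * (traceFst ρ)⁻¹).trace := by
    rw [conjTranspose_mul, hrt, Matrix.mul_assoc, trace_mul_comm, Matrix.mul_assoc,
      Matrix.mul_assoc, hRr, Matrix.mul_one, trace_mul_ampl,
      traceFst_conjTranspose, hK, Matrix.mul_assoc]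
  have t3 : ((ampl K * R)ᴴ * (Y * r)).trace = (Tᴴ * T * (traceFst ρ)⁻¹).trace := by
    rw [conjTranspose_mul, hRt, ampl_conjTranspose, Matrix.mul_assoc, trace_mul_comm,
      Matrix.mul_assoc, Matrix.mul_assoc, hrR, Matrix.mul_one, trace_ampl_mul, hKt, ← hT,
      Matrix.mul_assoc, trace_mul_comm]
  have t4 : ((ampl K * R)ᴴ * (ampl K * R)).trace = (Tᴴ * T * (traceFst ρ)⁻¹).trace := by
    rw [conjTranspose_mul, hRt, ampl_conjTranspose, Matrix.mul_assoc, trace_mul_comm,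
      Matrix.mul_assoc, Matrix.mul_assoc, hRR, trace_ampl_mul, traceFst_ampl_mul, hKt, hK,
      Matrix.mul_assoc T, nonsing_inv_mul _ ((isUnit_iff_isUnit_det _).1 hρ'.isUnit),
      Matrix.mul_one, Matrix.mul_assoc, trace_mul_comm]
  rw [conjTranspose_sub, Matrix.sub_mul, Matrix.mul_sub, Matrix.mul_sub, trace_sub, trace_sub,
    trace_sub, t1, t2, t3, t4, sub_self, sub_zero, Complex.sub_re] at h
  linarith

/-- The adjoint `X ↦ ρ₁^(-1/2) Tr₁ (ρ^(1/2) X)` of the isometry `X ↦ ρ^(1/2) (I ⊗ ρ₁^(-1/2) X)`. -/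
def coembedding (ρ : Matrix (m × n) (m × n) ℂ) :
    Matrix (m × n) (m × n) ℂ →ₗ[ℂ] Matrix n n ℂ where
  toFun X := power (traceFst ρ) (-(1 / 2)) * traceFst (power ρ (1 / 2) * X)
  map_add' X Y := by
    rw [Matrix.mul_add, traceFst_add, Matrix.mul_add]
  map_smul' c X := by
    rw [Matrix.mul_smul, RingHom.id_apply, traceFst_smul, Matrix.mul_smul]

theorem coembedding_apply (ρ X : Matrix (m × n) (m × n) ℂ) :
    coembedding ρ X = power (traceFst ρ) (-(1 / 2)) * traceFst (power ρ (1 / 2) * X) := rfl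

/-- This yields data processing for the Petz map. Contraction and form comparison are both instances
of `trace_traceFst_mul_inv_le`, for `(ρ^(1/2) X)*` and for `(I ⊗ γ^(1/2) ρ₁^(-1/2)) ρ^(1/2) X`. -/
theorem modularContraction_coembedding (hρ : ρ.PosDef) (hρ' : (traceFst ρ).PosDef)
    {γ : Matrix n n ℂ} (hγ : γ.PosDef) :
    ModularContraction (traceFst ρ) γ ρ (petz ρ γ) (coembedding ρ) := by
  set R := power ρ (1 / 2) with hR
  set r := power (traceFst ρ) (-(1 / 2)) with hr
  have hRt : Rᴴ = R := power_conjTranspose hρ _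
  have hrt : rᴴ = r := power_conjTranspose hρ' _
  have hRR : R * R = ρ := power_half_mul_self hρ
  have hrr : r * r = (traceFst ρ)⁻¹ := power_neg_half_mul_self hρ'
  have hadj : ∀ X, (coembedding ρ X)ᴴ = (traceFst (R * X))ᴴ * r := fun X => by
    rw [coembedding_apply, conjTranspose_mul, ← hr, ← hR, hrt]
  refine ⟨fun X => ?_, fun X => ?_, fun X => congrArg Complex.re ?_,
    congrArg Complex.re (trace_traceFst ρ)⟩
  · have h := trace_traceFst_mul_inv_le hρ hρ' (R * X)ᴴ
    rw [conjTranspose_conjTranspose, traceFst_conjTranspose, conjTranspose_conjTranspose] at h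
    have e1 : ((coembedding ρ X)ᴴ * coembedding ρ X).trace
        = (traceFst (R * X) * (traceFst (R * X))ᴴ * (traceFst ρ)⁻¹).trace := by
      rw [hadj, coembedding_apply, ← hr, ← hR, Matrix.mul_assoc, ← Matrix.mul_assoc r, hrr,
        trace_mul_comm, Matrix.mul_assoc, trace_mul_comm]
    have e2 : (R * X * (R * X)ᴴ * ρ⁻¹).trace = (Xᴴ * X).trace := by
      have : R * X * (R * X)ᴴ * ρ⁻¹ = R * (X * Xᴴ * (R * ρ⁻¹)) := by
        rw [conjTranspose_mul, hRt]
        simp only [Matrix.mul_assoc]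
      rw [this, power_half_mul_inv hρ, trace_mul_comm, Matrix.mul_assoc,
        power_neg_half_mul_half hρ, Matrix.mul_one, trace_mul_comm]
    rwa [e1, ← e2]
  · set g := power γ (1 / 2) with hg
    have hgt : gᴴ = g := power_conjTranspose hγ _
    have hgg : g * g = γ := power_half_mul_self hγ
    have h := trace_traceFst_mul_inv_le hρ hρ' (ampl (g * r) * (R * X))
    rw [traceFst_ampl_mul] at h
    have e1 : (coembedding ρ X)ᴴ * γ * coembedding ρ X * (traceFst ρ)⁻¹
        = (g * r * traceFst (R * X))ᴴ * (g * r * traceFst (R * X)) * (traceFst ρ)⁻¹ := by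
      rw [hadj, coembedding_apply, ← hr, ← hR, conjTranspose_mul, conjTranspose_mul, hgt, hrt,
        ← hgg]
      simp only [Matrix.mul_assoc]
    have e2 : Xᴴ * petz ρ γ * X * ρ⁻¹
        = (ampl (g * r) * (R * X))ᴴ * (ampl (g * r) * (R * X)) * ρ⁻¹ := by
      rw [petz, ← hR, ← hr, ← hgg, conjTranspose_mul, conjTranspose_mul, ampl_conjTranspose,
        conjTranspose_mul, hgt, hrt, hRt]
      simp only [Matrix.mul_assoc, ampl_mul]
    rwa [e1, e2]
  · rw [hadj, Matrix.mul_assoc, power_neg_half_mul_half hρ', Matrix.mul_one,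
      ← traceFst_conjTranspose, trace_traceFst, conjTranspose_mul, hRt]

end

section

open Matrix

variable {a b c m n : Type*} [Fintype a] [DecidableEq a] [Fintype b] [DecidableEq b]
  [Fintype c] [DecidableEq c] [Fintype m] [DecidableEq m] [Fintype n] [DecidableEq n]

/-! ### Functions of tensor products -/

theorem spec_add {ι : Type*} [Fintype ι] [DecidableEq ι] (Q : Matrix n ι ℂ) (q r : ι → ℝ) :
    spec Q (fun i => q i + r i) = spec Q q + spec Q r := by
  rw [spec, spec, spec, ← Matrix.add_mul, ← Matrix.mul_add, diagonal_add]
  simp only [Complex.ofReal_add]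

theorem power_kronecker {A : Matrix m m ℂ} {B : Matrix n n ℂ} (hA : A.PosDef) (hB : B.PosDef)
    (s : ℝ) : power (A ⊗ₖ B) s = power A s ⊗ₖ power B s := by
  obtain ⟨P, p, hP⟩ := exists_isSpec hA
  obtain ⟨Q, q, hQ⟩ := exists_isSpec hB
  rw [(hP.kronecker hQ).power_eq, hP.power_eq, hQ.power_eq, spec_kronecker]
  congr 1
  funext k
  exact Real.mul_rpow (hP.pos _).le (hQ.pos _).le

theorem cfc_log_kronecker {A : Matrix m m ℂ} {B : Matrix n n ℂ} (hA : A.PosDef) (hB : B.PosDef) :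
    cfc Real.log (A ⊗ₖ B) = cfc Real.log A ⊗ₖ 1 + 1 ⊗ₖ cfc Real.log B := by
  obtain ⟨P, p, hP⟩ := exists_isSpec hA
  obtain ⟨Q, q, hQ⟩ := exists_isSpec hB
  rw [(hP.kronecker hQ).cfc_eq, hP.cfc_eq, hQ.cfc_eq, ← spec_one hP.right, ← spec_one hQ.right,
    spec_kronecker, spec_kronecker, ← spec_add]
  congr 1
  funext k
  rw [mul_one, one_mul, Real.log_mul (hP.pos _).ne' (hQ.pos _).ne']

theorem cfc_reindex {A : Matrix m m ℂ} (hA : A.PosDef) (e : m ≃ n) (f : ℝ → ℝ) :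
    cfc f (reindex e e A) = reindex e e (cfc f A) := by
  obtain ⟨P, p, hP⟩ := exists_isSpec hA
  rw [(hP.reindex e).cfc_eq, hP.cfc_eq, spec_reindex]

theorem power_tensorABC {A : Matrix (a × b) (a × b) ℂ} {C : Matrix c c ℂ} (hA : A.PosDef)
    (hC : C.PosDef) (s : ℝ) : power (tensorABC A C) s = tensorABC (power A s) (power C s) := by
  rw [tensorABC, tensorABC, ← power_kronecker hA hC]
  exact cfc_reindex (hA.kronecker hC) _ _

theorem cfc_log_tensorABC {A : Matrix (a × b) (a × b) ℂ} {C : Matrix c c ℂ} (hA : A.PosDef)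
    (hC : C.PosDef) :
    cfc Real.log (tensorABC A C) = tensorABC (cfc Real.log A) 1 + tensorABC 1 (cfc Real.log C) := by
  rw [tensorABC, cfc_reindex (hA.kronecker hC), cfc_log_kronecker hA hC]
  rfl

theorem posDef_tensorABC {A : Matrix (a × b) (a × b) ℂ} {C : Matrix c c ℂ} (hA : A.PosDef)
    (hC : C.PosDef) : (tensorABC A C).PosDef :=
  (hA.kronecker hC).submatrix (Equiv.injective _)

/-! ### Partial traces of tripartite states -/

theorem traceSnd_eq_traceFst (M : Matrix (m × n) (m × n) ℂ) :
    traceSnd M = traceFst (reindex (Equiv.prodComm m n) (Equiv.prodComm m n) M) := rfl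

theorem traceSnd_posDef [Nonempty n] {M : Matrix (m × n) (m × n) ℂ} (hM : M.PosDef) :
    (traceSnd M).PosDef := by
  rw [traceSnd_eq_traceFst]
  exact traceFst_posDef (hM.submatrix (Equiv.injective _))

theorem trace_reindex (e : m ≃ n) (M : Matrix m m ℂ) : (reindex e e M).trace = M.trace := by
  simp only [trace, diag_apply, reindex_apply, submatrix_apply]
  exact Equiv.sum_comp e.symm fun i => M i i

theorem trace_traceSnd (M : Matrix (m × n) (m × n) ℂ) : (traceSnd M).trace = M.trace := by
  rw [traceSnd_eq_traceFst, trace_traceFst, trace_reindex]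

theorem trace_mul_kronecker_one (M : Matrix (m × n) (m × n) ℂ) (X : Matrix m m ℂ) :
    (M * (X ⊗ₖ (1 : Matrix n n ℂ))).trace = (traceSnd M * X).trace := by
  rw [traceSnd_eq_traceFst, ← trace_mul_ampl, ← trace_reindex (Equiv.prodComm m n)]
  congr 1
  ext i j
  simp only [reindex_apply, submatrix_apply, mul_apply, ampl]
  rw [← Equiv.sum_comp (Equiv.prodComm m n)]
  exact Finset.sum_congr rfl fun k _ => congrArg (_ * ·) (mul_comm _ _)

theorem trace_mul_tensorABC (M : Matrix (a × b × c) (a × b × c) ℂ) (X : Matrix (a × b) (a × b) ℂ)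
    (Y : Matrix c c ℂ) :
    (M * tensorABC X Y).trace
      = (reindex (Equiv.prodAssoc a b c).symm (Equiv.prodAssoc a b c).symm M * (X ⊗ₖ Y)).trace := by
  rw [tensorABC, ← trace_reindex (Equiv.prodAssoc a b c).symm]
  congr 1
  ext i j
  simp only [reindex_apply, submatrix_apply, mul_apply]
  rw [← Equiv.sum_comp (Equiv.prodAssoc a b c)]
  simp

theorem traceFst_reindex (ρ : Matrix (a × b × c) (a × b × c) ℂ) :
    traceFst (reindex (Equiv.prodAssoc a b c).symm (Equiv.prodAssoc a b c).symm ρ) = redC ρ := by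
  ext j k
  simp only [traceFst, redC, redBC, of_apply, Fintype.sum_prod_type, reindex_apply,
    submatrix_apply]
  exact Finset.sum_comm

theorem traceFst_redAB (ρ : Matrix (a × b × c) (a × b × c) ℂ) : traceFst (redAB ρ) = redB ρ := by
  ext j k
  simp only [traceFst, traceSnd, redAB, redB, redBC, of_apply, reindex_apply, submatrix_apply]
  exact Finset.sum_comm

theorem traceFst_tensorABC (X : Matrix (a × b) (a × b) ℂ) (Y : Matrix c c ℂ) :
    traceFst (tensorABC X Y) = traceFst X ⊗ₖ Y := by
  ext j k
  simp [traceFst, tensorABC, Finset.sum_mul]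

theorem trace_redAB (ρ : Matrix (a × b × c) (a × b × c) ℂ) : (redAB ρ).trace = ρ.trace := by
  rw [redAB, trace_traceSnd, trace_reindex]

theorem trace_redC (ρ : Matrix (a × b × c) (a × b × c) ℂ) : (redC ρ).trace = ρ.trace := by
  rw [redC, trace_traceFst, redBC, trace_traceFst]

theorem trace_tensorABC (X : Matrix (a × b) (a × b) ℂ) (Y : Matrix c c ℂ) :
    (tensorABC X Y).trace = X.trace * Y.trace := by
  rw [tensorABC, trace_reindex, trace_kronecker]

/-- The entropy deficit of strong subadditivity is a decrease of relative entropy. -/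
theorem relEntropy_sub_relEntropy {ρ : Matrix (a × b × c) (a × b × c) ℂ}
    (hAB : (redAB ρ).PosDef) (hB : (redB ρ).PosDef) (hC : (redC ρ).PosDef) :
    relEntropy ρ (tensorABC (redAB ρ) (redC ρ)) - relEntropy (redBC ρ) (redB ρ ⊗ₖ redC ρ)
      = entropy (redAB ρ) + entropy (redBC ρ) - entropy ρ - entropy (redB ρ) := by
  -- Both relative entropies contain the same term `Tr ρ_C log ρ_C`, which cancels.
  have h1 : (redBC ρ * (1 ⊗ₖ cfc Real.log (redC ρ))).trace
      = (redC ρ * cfc Real.log (redC ρ)).trace := trace_mul_ampl _ _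
  have h2 : (reindex (Equiv.prodAssoc a b c).symm (Equiv.prodAssoc a b c).symm ρ
      * (1 ⊗ₖ cfc Real.log (redC ρ))).trace = (redC ρ * cfc Real.log (redC ρ)).trace := by
    rw [← traceFst_reindex]
    exact trace_mul_ampl _ _
  simp only [relEntropy, entropy]
  rw [cfc_log_tensorABC hAB hC, cfc_log_kronecker hB hC, Matrix.mul_add, Matrix.mul_add, trace_add,
    trace_add, trace_mul_tensorABC, trace_mul_tensorABC, trace_mul_kronecker_one,
    trace_mul_kronecker_one, h1, h2, Complex.add_re, Complex.add_re]
  change _ - ((redAB ρ * _).trace.re + _) - (_ - ((redB ρ * _).trace.re + _)) = _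
  ring

end

end QState

end

/-! ### Strong subadditivity with remainder. -/

theorem corollary7p2
    {a b c : Type*} [Fintype a] [DecidableEq a] [Fintype b] [DecidableEq b]
    [Fintype c] [DecidableEq c]
    (ρ : Matrix (a × b × c) (a × b × c) ℂ) (hρ : QState.IsFaithfulState ρ) :
    (∀ β : ℝ, 0 < β → β < 1 →
      QState.constN β
          (QState.superNorm
            (QState.modular (QState.tensorABC (QState.redAB ρ) (QState.redC ρ)) ρ))
        * QState.hsNorm
            (QState.ampl
                ((QState.power (QState.redB ρ) β ⊗ₖ QState.power (QState.redC ρ) β)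
                  * QState.power (QState.redBC ρ) (-β))
              * QState.power ρ (1 / 2)
            - QState.tensorABC (QState.power (QState.redAB ρ) β) (QState.power (QState.redC ρ) β)
              * QState.power ρ (1 / 2 - β)) ^ (1 / QState.alpha β)
      ≤ QState.entropy (QState.redAB ρ) + QState.entropy (QState.redBC ρ)
          - QState.entropy ρ - QState.entropy (QState.redB ρ))
    ∧ (Real.pi / 8) ^ 4 * QState.opNorm ρ⁻¹ ^ (-2 : ℤ)
        * QState.traceNorm
            (QState.petz ρ (QState.redB ρ ⊗ₖ QState.redC ρ)
              - QState.tensorABC (QState.redAB ρ) (QState.redC ρ)) ^ 4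
      ≤ QState.entropy (QState.redAB ρ) + QState.entropy (QState.redBC ρ)
          - QState.entropy ρ - QState.entropy (QState.redB ρ)
    ∧ (QState.entropy (QState.redAB ρ) + QState.entropy (QState.redBC ρ)
          - QState.entropy ρ - QState.entropy (QState.redB ρ) = 0
        ↔ QState.petz ρ (QState.redB ρ ⊗ₖ QState.redC ρ)
            = QState.tensorABC (QState.redAB ρ) (QState.redC ρ)) := by
  open QState in
  obtain ⟨hpos, htr⟩ := hρ
  -- Trace one excludes empty index types, for which the partial traces could fail to be controlled.
  have hne : Nonempty (a × b × c) := by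
    by_contra h
    rw [not_nonempty_iff] at h
    simp [Matrix.trace] at htr
  obtain ⟨⟨i, j, k⟩⟩ := hne
  have : Nonempty a := ⟨i⟩
  have : Nonempty b := ⟨j⟩
  have : Nonempty c := ⟨k⟩
  have hBC : (redBC ρ).PosDef := traceFst_posDef hpos
  have hB : (redB ρ).PosDef := traceSnd_posDef hBC
  have hC : (redC ρ).PosDef := traceFst_posDef hBC
  have hAB : (redAB ρ).PosDef := traceSnd_posDef (hpos.submatrix (Equiv.injective _))
  set σ := tensorABC (redAB ρ) (redC ρ) with hσdef
  set τ := redB ρ ⊗ₖ redC ρ with hτdef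
  have hσ : σ.PosDef := posDef_tensorABC hAB hC
  have hτ : τ.PosDef := hB.kronecker hC
  have hστ : traceFst σ = τ := by
    rw [hσdef, traceFst_tensorABC, traceFst_redAB]
  have htrre : ρ.trace.re = 1 := by rw [htr, Complex.one_re]
  have hσtr : σ.trace = 1 := by
    rw [hσdef, trace_tensorABC, trace_redAB, trace_redC, htr, one_mul]
  have hτtr : τ.trace = 1 := by rw [← hστ, trace_traceFst, hσtr]
  have hemb : ModularEmbedding ρ σ (redBC ρ) τ (embedding ρ) :=
    hστ ▸ modularEmbedding_embedding hpos hBC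
  have hdef := relEntropy_sub_relEntropy hAB hB hC
  rw [← hσdef, ← hτdef] at hdef
  rw [← hdef]
  have hrec : (Real.pi / 8) ^ 4 * opNorm ρ⁻¹ ^ (-2 : ℤ) * traceNorm (petz ρ τ - σ) ^ 4
      ≤ relEntropy ρ σ - relEntropy (redBC ρ) τ := by
    obtain ⟨h1, h2⟩ := hemb.half_pow_four_le hpos hσ hBC hτ htrre (by rw [hσtr, Complex.one_re])
    have hY : hsNorm (embedding ρ (power τ (1 / 2))) = 1 := by
      refine (pow_left_inj₀ (hsNorm_nonneg _) zero_le_one two_ne_zero).1 ?_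
      rw [hsNorm_sq_eq_trace, ← petz_eq hpos hBC hτ, trace_petz hpos hBC, hτtr, Complex.one_re,
        one_pow]
    have hZ : hsNorm (power σ (1 / 2)) = 1 := by
      refine (pow_left_inj₀ (hsNorm_nonneg _) zero_le_one two_ne_zero).1 ?_
      rw [hsNorm_sq_eq_trace, power_conjTranspose hσ, power_half_mul_self hσ, hσtr, Complex.one_re,
        one_pow]
    -- Both Hilbert–Schmidt norms are one, so the trace norm is at most twice the 2-norm; this
    -- factor turns `π/4` into `π/8`.
    have h3 := traceNorm_sub_le (embedding ρ (power τ (1 / 2))) (power σ (1 / 2))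
    rw [← petz_eq hpos hBC hτ, power_conjTranspose hσ, power_half_mul_self hσ, hY, hZ] at h3
    have h4 : 0 ≤ traceNorm (petz ρ τ - σ) := by
      have hM := (isHermitian_petz hpos hBC hτ).sub hσ.isHermitian
      rw [hM.eq_spec, traceNorm_spec (Unitary.coe_star_mul_self _) (Unitary.coe_mul_star_self _)]
      positivity
    have h5 := pow_le_pow_left₀ h4 h3 4
    have h6 : (Real.pi / 8) ^ 4 * opNorm ρ⁻¹ ^ (-2 : ℤ) * traceNorm (petz ρ τ - σ) ^ 4
        = (Real.pi / 8) ^ 4 * traceNorm (petz ρ τ - σ) ^ 4 / opNorm ρ⁻¹ ^ 2 := by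
      rw [zpow_neg, div_eq_mul_inv, zpow_ofNat]
      ring
    rw [h6, div_le_iff₀' (by positivity)]
    refine le_trans ?_ h1
    refine (mul_le_mul_of_nonneg_left h5 (by positivity)).trans_eq ?_
    ring
  refine ⟨fun β h0 h1 => ?_, hrec, fun h => ?_, fun h => ?_⟩
  · have h := hemb.constN_mul_le hpos hσ hBC hτ htrre h0 h1
    rw [embedding_apply, Matrix.mul_assoc, hσdef, power_tensorABC hAB hC, ← hσdef, hτdef,
      power_kronecker hB hC, ← hτdef] at h
    have e : power (redBC ρ) (1 / 2 - β) * power (traceFst ρ) (-(1 / 2))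
        = power (redBC ρ) (-β) := by
      change power (redBC ρ) (1 / 2 - β) * power (redBC ρ) (-(1 / 2)) = _
      rw [power_mul_power hBC]
      congr 1
      ring
    rw [e] at h
    exact h
  · rw [h] at hrec
    have hop : 0 < opNorm ρ⁻¹ :=
      (hemb.half_pow_four_le hpos hσ hBC hτ htrre (by rw [hσtr, Complex.one_re])).2
    have hM := (isHermitian_petz hpos hBC hτ).sub hσ.isHermitian
    have hpi := Real.pi_pos
    have h0 : traceNorm (petz ρ τ - σ) ^ 4 ≤ 0 :=
      nonpos_of_mul_nonpos_right hrec (by positivity)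
    have h00 : traceNorm (petz ρ τ - σ) = 0 := by
      have : traceNorm (petz ρ τ - σ) ^ 4 = 0 := le_antisymm h0 (by positivity)
      exact pow_eq_zero_iff (by norm_num) |>.1 this
    exact sub_eq_zero.1 (traceNorm_eq_zero hM h00)
  -- The recovery hypothesis replaces the recovered operator by `σ`, so the two data processing
  -- inequalities are opposite.
  · have hcon : ModularContraction (redBC ρ) τ ρ σ (coembedding ρ) :=
      h ▸ modularContraction_coembedding hpos hBC hτ
    have h1 := hcon.relEntropy_le hBC hτ hpos hσ
    have h2 := hemb.relEntropy_le hpos hσ hBC hτ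
    linarith
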